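/- Let $(X_1,Y_1),(X_2,Y_2),\ldots$ be i.i.d. random elements of $\mathbb{R}^n\times\mathbb{R}$ with $Y_i = X_i^T\beta^* + \epsilon_i$ for some $\beta^*\in\mathbb{R}^n$, where the $\epsilon_i$ are i.i.d. with mean zero and variance $\sigma^2\in(0,\infty)$ and are independent of $(X_i)_{i\ge 1}$. Assume $\mathbb{E}\|X_1\|_2^2<\infty$ and $\mathbb{P}(|X_1^Tv|=0)<1$ for every unit vector $v\in\mathbb{R}^n$. Let $\mathcal{F}_k=\sigma(X_1,\ldots,X_k)$. For tuning parameters $(\gamma_k^2)_{k\ge1}$ and $\beta_0\in\mathbb{R}^n$, let $M_0=I$ and, for $k \geq 1$, $$\beta_k=\beta_{k-1}+\frac{M_{k-1}X_k\,(Y_k-\beta_{k-1}^TX_k)}{\gamma_k^2+X_k^TM_{k-1}X_k},\qquad M_k=\Big(I-\frac{M_{k-1}X_kX_k^T}{\gamma_k^2+X_k^TM_{k-1}X_k}\Big)M_{k-1}.$$ Let $V$ be an almost surely finite $(\mathcal{F}_k)_{k \geq 0}$-stopping time and, for a stopping time $T$, let $\mathcal{F}_T$ be its stopped $\sigma$-algebra.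 Let $f_k$, $k\ge1$, be $\mathcal{F}_{V+k}$-measurable with, almost surely, $f_k\in[0,1]$ for all $k$ and $f_k\to1$. With the residuals $r_k=Y_{V+k}-X_{V+k}^T\beta_{V+k-1}$, put $$\xi_1^2=r_1^2,\qquad \xi_{k+1}^2=\frac{1}{k+1}f_{k+1}r_{k+1}^2+\Big(1-\frac1{k+1}\Big)\xi_k^2\quad (k\ge1).$$ For an integer $\tau\ge1$ let $\phi_\tau(x)=\tau\mathbf{1}\{x>\tau\}+\tau^{-1}\mathbf{1}\{x<\tau^{-1}\}+x\mathbf{1}\{\tau^{-1}\le x\le\tau\}$. Assume that the tuning parameters satisfy: 1. $\gamma_k^2$ is $\sigma\big((X_1,Y_1),\ldots,(X_k,Y_k)\big)$-measurable for every $k\ge1$; 2. for some constants $0<\delta^2\le\Delta^2<\infty$, almost surely $\delta^2\le\gamma_k^2\le\Delta^2$ for all $1\le k\le V$; 3. almost surely $\gamma_{V+k}^2=\phi_\tau(\xi_k^2)$ for all $k\ge1$. Then $\xi_k^2$ and $\gamma_{V+k}^2$ are integrable for every $k\ge1$, and almost surely $$\lim_{k\to\infty}\mathbb{E}\big[\xi_k^2\,\big|\,\mathcal{F}_{V+k}\big]=\sigma^2.$$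 Moreover, almost surely, $$\phi_\tau(\sigma^2)\le\liminf_{k\to\infty}\mathbb{E}\big[\gamma_{V+k}^2\,\big|\,\mathcal{F}_{V+k}\big]\le\limsup_{k\to\infty}\mathbb{E}\big[\gamma_{V+k}^2\,\big|\,\mathcal{F}_{V+k}\big]\le\phi_\tau(\sigma^2+\tau^{-1}).$$ -/

import Mathlib

open MeasureTheory ProbabilityTheory Filter Topology
open scoped Matrix

/-- `σ(Z₁, …, Z_k)`, as a filtration indexed by `k = 0, 1, 2, …` (trivial at `k = 0`).
Sequences are indexed from `1`; the value `Z 0` is never used. -/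
def sigmaUpTo {Ω E : Type*} [mΩ : MeasurableSpace Ω] [mE : MeasurableSpace E]
    (Z : ℕ → Ω → E) (hZ : ∀ i, 1 ≤ i → Measurable (Z i)) : Filtration ℕ mΩ where
  seq k := ⨆ j ∈ Set.Icc 1 k, MeasurableSpace.comap (Z j) mE
  mono' _ _ hkl := biSup_mono fun _ hj => ⟨hj.1, hj.2.trans hkl⟩
  le' _ := iSup₂_le fun j hj => (hZ j hj.1).comap_le

/-- The linear model: `(X_i, Y_i)`, `i ≥ 1`, are i.i.d., `Y_i = X_iᵀ β* + ε_i`, and the `ε_i` are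
i.i.d. with mean zero and variance `σ² ∈ (0, ∞)`, independent of `(X_i)_{i ≥ 1}`. -/
structure IsLinearModel {Ω : Type*} [MeasurableSpace Ω] (μ : Measure Ω) {n : ℕ}
    (X : ℕ → Ω → (Fin n → ℝ)) (Y ε : ℕ → Ω → ℝ) (βstar : Fin n → ℝ) (σ : ℝ) : Prop where
  iIndep_obs : iIndepFun (fun (i : ℕ) (ω : Ω) => (X (i + 1) ω, Y (i + 1) ω)) μ
  identDistrib_obs : ∀ i, 1 ≤ i →
    IdentDistrib (fun ω => (X i ω, Y i ω)) (fun ω => (X 1 ω, Y 1 ω)) μ μ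
  model : ∀ i, 1 ≤ i → ∀ ω, Y i ω = X i ω ⬝ᵥ βstar + ε i ω
  iIndep_noise : iIndepFun (fun i : ℕ => ε (i + 1)) μ
  identDistrib_noise : ∀ i, 1 ≤ i → IdentDistrib (ε i) (ε 1) μ μ
  indep_noise_cov : IndepFun (fun ω (i : ℕ) => ε (i + 1) ω) (fun ω (i : ℕ) => X (i + 1) ω) μ
  memLp_noise : MemLp (ε 1) 2 μ
  mean_noise : ∫ ω, ε 1 ω ∂μ = 0
  sigma_pos : 0 < σ
  variance_noise : variance (ε 1) μ = σ ^ 2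

/-- The estimated covariance `M_k`, with `M_0 = I` and
`M_k = (I - M_{k-1} X_k X_kᵀ / (γ_k² + X_kᵀ M_{k-1} X_k)) M_{k-1}`.
The argument `γsq k` is the tuning parameter `γ_k²`. -/
noncomputable def estCov {Ω : Type*} {n : ℕ} (X : ℕ → Ω → (Fin n → ℝ)) (γsq : ℕ → Ω → ℝ) :
    ℕ → Ω → Matrix (Fin n) (Fin n) ℝ
  | 0, _ => 1
  | k + 1, ω =>
    (1 - (γsq (k + 1) ω + X (k + 1) ω ⬝ᵥ (estCov X γsq k ω *ᵥ X (k + 1) ω))⁻¹ •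
      (estCov X γsq k ω * Matrix.vecMulVec (X (k + 1) ω) (X (k + 1) ω))) * estCov X γsq k ω

/-- The parameter estimate `β_k`, with `β_0` given and
`β_k = β_{k-1} + M_{k-1} X_k (Y_k - β_{k-1}ᵀ X_k) / (γ_k² + X_kᵀ M_{k-1} X_k)`. -/
noncomputable def estParam {Ω : Type*} {n : ℕ} (X : ℕ → Ω → (Fin n → ℝ)) (Y : ℕ → Ω → ℝ)
    (γsq : ℕ → Ω → ℝ) (β₀ : Fin n → ℝ) : ℕ → Ω → (Fin n → ℝ)
  | 0, _ => β₀
  | k + 1, ω =>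
    estParam X Y γsq β₀ k ω +
      ((Y (k + 1) ω - estParam X Y γsq β₀ k ω ⬝ᵥ X (k + 1) ω) /
        (γsq (k + 1) ω + X (k + 1) ω ⬝ᵥ (estCov X γsq k ω *ᵥ X (k + 1) ω))) •
        (estCov X γsq k ω *ᵥ X (k + 1) ω)

/-- The index `V + k` as a natural number (used where `V` is finite). -/
def shiftIdx {Ω : Type*} (V : Ω → WithTop ℕ) (k : ℕ) (ω : Ω) : ℕ := (V ω).untopD 0 + k

/-- The residual `r_k = Y_{V+k} - X_{V+k}ᵀ β_{V+k-1}`, for `k ≥ 1`. -/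
noncomputable def kResidual {Ω : Type*} {n : ℕ} (X : ℕ → Ω → (Fin n → ℝ)) (Y : ℕ → Ω → ℝ)
    (γsq : ℕ → Ω → ℝ) (β₀ : Fin n → ℝ) (V : Ω → WithTop ℕ) (k : ℕ) (ω : Ω) : ℝ :=
  Y (shiftIdx V k ω) ω -
    X (shiftIdx V k ω) ω ⬝ᵥ estParam X Y γsq β₀ (shiftIdx V k ω - 1) ω

/-- The estimator `ξ_k²`, `k ≥ 1`: `ξ_1² = r_1²` and
`ξ_{k+1}² = f_{k+1} r_{k+1}² / (k+1) + (1 - 1/(k+1)) ξ_k²`. The value at `k = 0` is not used. -/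
noncomputable def xiSq {Ω : Type*} (r f : ℕ → Ω → ℝ) : ℕ → Ω → ℝ
  | 0, _ => 0
  | 1, ω => r 1 ω ^ 2
  | k + 2, ω =>
    1 / ((k : ℝ) + 2) * f (k + 2) ω * r (k + 2) ω ^ 2 +
      (1 - 1 / ((k : ℝ) + 2)) * xiSq r f (k + 1) ω

open Classical in
/-- The truncation `φ_τ(x) = τ 1{x > τ} + τ⁻¹ 1{x < τ⁻¹} + x 1{τ⁻¹ ≤ x ≤ τ}`. -/
noncomputable def phiTrunc (τ : ℕ) (x : ℝ) : ℝ :=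
  (if x > (τ : ℝ) then (τ : ℝ) else 0) + (if x < (τ : ℝ)⁻¹ then (τ : ℝ)⁻¹ else 0) +
    (if (τ : ℝ)⁻¹ ≤ x ∧ x ≤ (τ : ℝ) then x else 0)

set_option linter.unusedSectionVars false

/-! ### Deterministic linear algebra of the recursion -/

section Algebra

variable {n : ℕ}

/-- The regularised information form `P_m u = u + ∑_{i ≤ m} X_i (X_i ⬝ u) / γ_i`. -/
noncomputable def infoApply (x : ℕ → Fin n → ℝ) (g : ℕ → ℝ) (m : ℕ) (u : Fin n → ℝ) : Fin n → ℝ :=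
  u + ∑ i ∈ Finset.range m, ((x (i + 1) ⬝ᵥ u) / g (i + 1)) • x (i + 1)

theorem infoApply_succ (x : ℕ → Fin n → ℝ) (g : ℕ → ℝ) (m : ℕ) (u : Fin n → ℝ) :
    infoApply x g (m + 1) u =
      infoApply x g m u + ((x (m + 1) ⬝ᵥ u) / g (m + 1)) • x (m + 1) := by
  simp [infoApply, Finset.sum_range_succ, add_assoc]

theorem infoApply_add (x : ℕ → Fin n → ℝ) (g : ℕ → ℝ) (m : ℕ) (u v : Fin n → ℝ) :
    infoApply x g m (u + v) = infoApply x g m u + infoApply x g m v := by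
  simp only [infoApply, dotProduct_add, add_div, add_smul, Finset.sum_add_distrib]
  abel

theorem infoApply_smul (x : ℕ → Fin n → ℝ) (g : ℕ → ℝ) (m : ℕ) (c : ℝ) (u : Fin n → ℝ) :
    infoApply x g m (c • u) = c • infoApply x g m u := by
  simp only [infoApply, dotProduct_smul, smul_add, Finset.smul_sum, smul_smul, smul_eq_mul,
    mul_div_assoc]

theorem dotProduct_infoApply (x : ℕ → Fin n → ℝ) (g : ℕ → ℝ) (m : ℕ) (u : Fin n → ℝ) :
    u ⬝ᵥ infoApply x g m u =
      u ⬝ᵥ u + ∑ i ∈ Finset.range m, (x (i + 1) ⬝ᵥ u) ^ 2 / g (i + 1) := by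
  simp only [infoApply, dotProduct_add, dotProduct_sum, dotProduct_smul, smul_eq_mul]
  congr 1
  refine Finset.sum_congr rfl fun i _ => ?_
  rw [dotProduct_comm u]; ring

theorem dotProduct_self_nonneg' (u : Fin n → ℝ) : 0 ≤ u ⬝ᵥ u :=
  Finset.sum_nonneg fun _ _ => mul_self_nonneg _

theorem dotProduct_sq_le (u v : Fin n → ℝ) : (u ⬝ᵥ v) ^ 2 ≤ (u ⬝ᵥ u) * (v ⬝ᵥ v) := by
  simpa [dotProduct, sq] using Finset.sum_mul_sq_le_sq_mul_sq Finset.univ u v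

theorem dotProduct_sum_smul_self_le {ι : Type*} (s : Finset ι) (c : ι → ℝ) (x : ι → Fin n → ℝ) :
    (∑ i ∈ s, c i • x i) ⬝ᵥ (∑ i ∈ s, c i • x i) ≤
      (∑ i ∈ s, x i ⬝ᵥ x i) * ∑ i ∈ s, c i ^ 2 := by
  have h : ∀ l, (∑ i ∈ s, c i • x i) l * (∑ i ∈ s, c i • x i) l ≤
      (∑ i ∈ s, c i ^ 2) * ∑ i ∈ s, x i l ^ 2 := fun l => by
    simpa [Finset.sum_apply, sq] using Finset.sum_mul_sq_le_sq_mul_sq s c (fun i => x i l)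
  calc _ ≤ ∑ l, (∑ i ∈ s, c i ^ 2) * ∑ i ∈ s, x i l ^ 2 := Finset.sum_le_sum fun l _ => h l
    _ = _ := by
      rw [← Finset.mul_sum, Finset.sum_comm, mul_comm]
      simp [dotProduct, sq]

theorem dotProduct_add_add_self_le (a b c : Fin n → ℝ) :
    (a + b + c) ⬝ᵥ (a + b + c) ≤ 3 * (a ⬝ᵥ a + b ⬝ᵥ b + c ⬝ᵥ c) := by
  simp only [dotProduct, Finset.mul_sum, ← Finset.sum_add_distrib]
  refine Finset.sum_le_sum fun l _ => ?_
  simp only [Pi.add_apply]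
  nlinarith [sq_nonneg (a l - b l), sq_nonneg (a l - c l), sq_nonneg (b l - c l)]

/-- Energy bound for a solution `u` of the normal equations. -/
theorem dotProduct_infoApply_le_of_eq (x : ℕ → Fin n → ℝ) (g ε : ℕ → ℝ) (hg : ∀ i, 0 < g (i + 1))
    (m : ℕ) (u e₀ : Fin n → ℝ)
    (h : infoApply x g m u = e₀ + ∑ i ∈ Finset.range m, (ε (i + 1) / g (i + 1)) • x (i + 1)) :
    u ⬝ᵥ infoApply x g m u ≤ e₀ ⬝ᵥ e₀ + ∑ i ∈ Finset.range m, ε (i + 1) ^ 2 / g (i + 1) := by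
  have h1 := dotProduct_infoApply x g m u
  have h2 : u ⬝ᵥ infoApply x g m u ≤ (u ⬝ᵥ u + e₀ ⬝ᵥ e₀) / 2 +
      ∑ i ∈ Finset.range m, ((x (i + 1) ⬝ᵥ u) ^ 2 / g (i + 1) + ε (i + 1) ^ 2 / g (i + 1)) / 2 := by
    rw [h, dotProduct_add, dotProduct_sum]
    refine add_le_add ?_ (Finset.sum_le_sum fun i _ => ?_)
    · rw [dotProduct, dotProduct, dotProduct, ← Finset.sum_add_distrib, Finset.sum_div]
      exact Finset.sum_le_sum fun l _ => by nlinarith [sq_nonneg (u l - e₀ l)]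
    · rw [dotProduct_smul, dotProduct_comm u, smul_eq_mul, ← add_div, div_mul_eq_mul_div,
        div_right_comm]
      refine div_le_div_of_nonneg_right ?_ (hg i).le
      nlinarith [sq_nonneg (ε (i + 1) - x (i + 1) ⬝ᵥ u)]
  rw [← Finset.sum_div, Finset.sum_add_distrib] at h2
  linarith

theorem dotProduct_self_le_sq_mul {κ : ℝ} (u p : Fin n → ℝ)
    (h : u ⬝ᵥ u ≤ κ * (u ⬝ᵥ p)) : u ⬝ᵥ u ≤ κ ^ 2 * (p ⬝ᵥ p) := by
  have h0 := dotProduct_self_nonneg' u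
  have h1 := dotProduct_sq_le u p
  have h3 : (u ⬝ᵥ u) ^ 2 ≤ (u ⬝ᵥ u) * (κ ^ 2 * (p ⬝ᵥ p)) := by
    calc (u ⬝ᵥ u) ^ 2 ≤ (κ * (u ⬝ᵥ p)) ^ 2 := pow_le_pow_left₀ h0 h 2
      _ = κ ^ 2 * (u ⬝ᵥ p) ^ 2 := by ring
      _ ≤ κ ^ 2 * ((u ⬝ᵥ u) * (p ⬝ᵥ p)) := by gcongr
      _ = _ := by ring
  rcases h0.eq_or_lt with h4 | h4
  · rw [← h4]; exact mul_nonneg (sq_nonneg _) (dotProduct_self_nonneg' _)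
  · nlinarith

end Algebra

section Recursion

variable {Ω : Type*} {n : ℕ} {X : ℕ → Ω → (Fin n → ℝ)} {γsq : ℕ → Ω → ℝ} {ω : Ω}

theorem infoApply_estCov (hγ : ∀ i, 0 < γsq (i + 1) ω) (m : ℕ) (u : Fin n → ℝ) :
    infoApply (fun i => X i ω) (fun i => γsq i ω) m (estCov X γsq m ω *ᵥ u) = u ∧
    0 ≤ u ⬝ᵥ (estCov X γsq m ω *ᵥ u) := by
  have key : ∀ m, (∀ u, infoApply (fun i => X i ω) (fun i => γsq i ω) m
      (estCov X γsq m ω *ᵥ u) = u) → ∀ u, 0 ≤ u ⬝ᵥ (estCov X γsq m ω *ᵥ u) := by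
    intro m h u
    have h1 := dotProduct_infoApply (fun i => X i ω) (fun i => γsq i ω) m (estCov X γsq m ω *ᵥ u)
    rw [h u] at h1
    rw [dotProduct_comm, h1]
    exact add_nonneg (dotProduct_self_nonneg' _)
      (Finset.sum_nonneg fun i _ => div_nonneg (sq_nonneg _) (hγ i).le)
  suffices h : ∀ u, infoApply (fun i => X i ω) (fun i => γsq i ω) m
      (estCov X γsq m ω *ᵥ u) = u from ⟨h u, key m h u⟩
  induction m with
  | zero => intro u; simp [infoApply, estCov]
  | succ m ih =>
    intro u
    have hs := key m ih (X (m + 1) ω)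
    set M := estCov X γsq m ω with hM
    set x := X (m + 1) ω with hx
    set s := x ⬝ᵥ (M *ᵥ x) with hs'
    set c := γsq (m + 1) ω with hc
    have hcpos : 0 < c := hγ m
    have hne : c + s ≠ 0 := by positivity
    have hM1 : estCov X γsq (m + 1) ω *ᵥ u =
        M *ᵥ u + (-((c + s)⁻¹ * (x ⬝ᵥ (M *ᵥ u)))) • (M *ᵥ x) := by
      rw [estCov, ← Matrix.mulVec_mulVec, Matrix.sub_mulVec, Matrix.one_mulVec, Matrix.smul_mulVec,
        ← Matrix.mulVec_mulVec, Matrix.vecMulVec_mulVec]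
      simp only [← hM, ← hx, ← hs', ← hc]
      rw [op_smul_eq_smul, Matrix.mulVec_smul, smul_smul, sub_eq_add_neg, neg_smul]
    rw [hM1, infoApply_add, infoApply_smul, infoApply_succ, infoApply_succ, ih, ih]
    simp only [← hx, ← hs', ← hc]
    rw [smul_add, smul_smul, add_assoc, ← add_smul, ← add_smul]
    convert add_zero u using 2
    convert zero_smul ℝ x using 2
    field_simp
    ring

theorem infoApply_estParam_sub {Y ε : ℕ → Ω → ℝ} {βstar β₀ : Fin n → ℝ}
    (hmodel : ∀ i, 1 ≤ i → Y i ω = X i ω ⬝ᵥ βstar + ε i ω)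
    (hγ : ∀ i, 0 < γsq (i + 1) ω) (m : ℕ) :
    infoApply (fun i => X i ω) (fun i => γsq i ω) m (estParam X Y γsq β₀ m ω - βstar) =
      (β₀ - βstar) + ∑ i ∈ Finset.range m, (ε (i + 1) ω / γsq (i + 1) ω) • X (i + 1) ω := by
  induction m with
  | zero => simp [infoApply, estParam]
  | succ m ih =>
    have hPM := (infoApply_estCov (X := X) hγ m (X (m + 1) ω)).1
    have hs := (infoApply_estCov (X := X) hγ m (X (m + 1) ω)).2
    set M := estCov X γsq m ω with hM
    set x := X (m + 1) ω with hx
    set s := x ⬝ᵥ (M *ᵥ x) with hs'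
    set c := γsq (m + 1) ω with hc
    set e := estParam X Y γsq β₀ m ω - βstar with he
    have hcpos : 0 < c := hγ m
    have hne : c + s ≠ 0 := by positivity
    have h1 : estParam X Y γsq β₀ (m + 1) ω - βstar =
        e + ((ε (m + 1) ω - x ⬝ᵥ e) / (c + s)) • (M *ᵥ x) := by
      rw [estParam]
      simp only [← hM, ← hx, ← hs', ← hc]
      rw [add_sub_right_comm, ← he]
      congr 3
      rw [hmodel (m + 1) (by omega), he, dotProduct_sub, dotProduct_comm _ x]
      ring
    rw [h1, infoApply_add, infoApply_smul, infoApply_succ, infoApply_succ, hPM, ih,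
      Finset.sum_range_succ]
    simp only [← hx, ← hs', ← hc]
    rw [smul_add, smul_smul, add_assoc, ← add_smul, ← add_smul, ← add_assoc (β₀ - βstar)]
    congr 2
    field_simp
    ring

end Recursion

/-! ### Averages -/

/-- Weighted averages of a null sequence vanish when the weights have linearly bounded sums. -/
theorem tendsto_weighted_average_zero {x w : ℕ → ℝ} {C : ℝ} (hx : ∀ i, 0 ≤ x i)
    (hC : ∀ m, ∑ i ∈ Finset.range m, x i ≤ C * m) (hw : Tendsto w atTop (𝓝 0)) :
    Tendsto (fun m : ℕ => (∑ i ∈ Finset.range m, x i * w i) / m) atTop (𝓝 0) := by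
  have hC0 : 0 ≤ C := by have := hC 1; simp at this; exact (hx 0).trans this
  rw [Metric.tendsto_atTop]
  intro η hη
  obtain ⟨N, hN⟩ := Metric.tendsto_atTop.1 hw (η / (2 * (C + 1))) (by positivity)
  set S := ∑ i ∈ Finset.range N, x i * |w i| with hS
  have hS0 : 0 ≤ S := Finset.sum_nonneg fun i _ => mul_nonneg (hx i) (abs_nonneg _)
  obtain ⟨N', hN'⟩ := exists_nat_gt (2 * S / η)
  refine ⟨max (N + 1) N', fun m hm => ?_⟩
  have hmN : N + 1 ≤ m := (le_max_left _ _).trans hm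
  have hm0 : (0 : ℝ) < m := by exact_mod_cast (by omega : 0 < m)
  have hmN' : 2 * S / η < m := hN'.trans_le (by exact_mod_cast (le_max_right _ _).trans hm)
  have hb : |∑ i ∈ Finset.range m, x i * w i| ≤ S + η / (2 * (C + 1)) * (C * m) := by
    calc |∑ i ∈ Finset.range m, x i * w i| ≤ ∑ i ∈ Finset.range m, x i * |w i| := by
          refine (Finset.abs_sum_le_sum_abs _ _).trans (Finset.sum_le_sum fun i _ => ?_)
          rw [abs_mul, abs_of_nonneg (hx i)]
      _ = S + ∑ i ∈ Finset.Ico N m, x i * |w i| := by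
          rw [hS, Finset.sum_range_add_sum_Ico _ (by omega)]
      _ ≤ S + ∑ i ∈ Finset.Ico N m, x i * (η / (2 * (C + 1))) := by
          gcongr with i hi
          · exact hx i
          · have := hN i (Finset.mem_Ico.1 hi).1
            rw [Real.dist_eq, sub_zero] at this
            exact this.le
      _ ≤ S + (η / (2 * (C + 1))) * (C * m) := by
          rw [← Finset.sum_mul, mul_comm]
          gcongr
          refine (Finset.sum_le_sum_of_subset_of_nonneg ?_ fun i _ _ => hx i).trans (hC m)
          intro i hi
          exact Finset.mem_range.2 (Finset.mem_Ico.1 hi).2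
  rw [Real.dist_eq, sub_zero, abs_div, abs_of_pos hm0, div_lt_iff₀ hm0]
  refine hb.trans_lt ?_
  have h1 : η / (2 * (C + 1)) * (C * m) ≤ η / 2 * m := by
    rw [div_mul_eq_mul_div, div_le_iff₀ (by positivity)]
    nlinarith [mul_pos hη hm0]
  have h2 : S < η / 2 * m := by
    rw [div_lt_iff₀ hη] at hmN'
    linarith
  linarith

theorem tendsto_average_zero {w : ℕ → ℝ} (hw : Tendsto w atTop (𝓝 0)) :
    Tendsto (fun m : ℕ => (∑ i ∈ Finset.range m, w i) / m) atTop (𝓝 0) := by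
  simpa using tendsto_weighted_average_zero (x := fun _ => 1) (C := 1) (by simp) (by simp) hw

theorem exists_sum_le_mul_of_tendsto {x : ℕ → ℝ} {a : ℝ}
    (h : Tendsto (fun m : ℕ => (∑ i ∈ Finset.range m, x i) / m) atTop (𝓝 a)) :
    ∃ C, 0 ≤ C ∧ ∀ m : ℕ, ∑ i ∈ Finset.range m, x i ≤ C * m := by
  obtain ⟨C, hC⟩ := h.bddAbove_range
  refine ⟨max C 0, le_max_right _ _, fun m => ?_⟩
  rcases Nat.eq_zero_or_pos m with rfl | hm
  · simp
  · have := hC ⟨m, rfl⟩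
    rw [div_le_iff₀ (by exact_mod_cast hm)] at this
    exact this.trans (by gcongr; exact le_max_left _ _)

/-! ### The truncation and the running average -/

theorem phiTrunc_eq {τ : ℕ} (hτ : 1 ≤ τ) (x : ℝ) :
    phiTrunc τ x = max (τ : ℝ)⁻¹ (min x τ) := by
  have h1 : (1 : ℝ) ≤ τ := by exact_mod_cast hτ
  have h2 : (τ : ℝ)⁻¹ ≤ 1 := inv_le_one_of_one_le₀ h1
  unfold phiTrunc
  rcases lt_or_ge (τ : ℝ) x with h | h
  · have : (τ : ℝ)⁻¹ ≤ x := by linarith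
    simp [h, not_lt.2 this, not_le.2 h, min_eq_right h.le, h2.trans h1]
  · rcases lt_or_ge x (τ : ℝ)⁻¹ with h3 | h3
    · simp [not_lt.2 h, h3, not_le.2 h3, min_eq_left h, h3.le]
    · simp [not_lt.2 h, not_lt.2 h3, h, h3]

theorem phiTrunc_mem {τ : ℕ} (hτ : 1 ≤ τ) (x : ℝ) :
    phiTrunc τ x ∈ Set.Icc (τ : ℝ)⁻¹ τ := by
  have h1 : (1 : ℝ) ≤ τ := by exact_mod_cast hτ
  have h2 : (τ : ℝ)⁻¹ ≤ 1 := inv_le_one_of_one_le₀ h1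
  rw [phiTrunc_eq hτ]
  exact ⟨le_max_left _ _, max_le (h2.trans h1) (min_le_right _ _)⟩

theorem abs_phiTrunc_sub_le {τ : ℕ} (hτ : 1 ≤ τ) (x y : ℝ) :
    |phiTrunc τ x - phiTrunc τ y| ≤ |x - y| := by
  rw [phiTrunc_eq hτ, phiTrunc_eq hτ]
  have h1 := abs_max_sub_max_le_max (τ : ℝ)⁻¹ (min x τ) (τ : ℝ)⁻¹ (min y τ)
  have h2 := abs_min_sub_min_le_max x (τ : ℝ) y τ
  simp only [sub_self, abs_zero, abs_nonneg, sup_of_le_left, sup_of_le_right] at h1 h2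
  exact h1.trans h2

theorem phiTrunc_mono {τ : ℕ} (hτ : 1 ≤ τ) : Monotone (phiTrunc τ) := by
  intro x y h
  rw [phiTrunc_eq hτ, phiTrunc_eq hτ]
  gcongr

theorem measurable_phiTrunc {τ : ℕ} (hτ : 1 ≤ τ) : Measurable (phiTrunc τ) := by
  have : phiTrunc τ = fun x => max (τ : ℝ)⁻¹ (min x τ) := funext (phiTrunc_eq hτ)
  rw [this]
  fun_prop

/-- Reciprocals of truncations are Lipschitz and bounded. -/
theorem sq_inv_phiTrunc_sub_le {τ : ℕ} (hτ : 1 ≤ τ) (x y : ℝ) :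
    ((phiTrunc τ x)⁻¹ - (phiTrunc τ y)⁻¹) ^ 2 ≤ (τ : ℝ) ^ 3 * min 1 |x - y| := by
  have h1 : (1 : ℝ) ≤ τ := by exact_mod_cast hτ
  have h0 : (0 : ℝ) < τ := by linarith
  obtain ⟨hx1, hx2⟩ := phiTrunc_mem hτ x
  obtain ⟨hy1, hy2⟩ := phiTrunc_mem hτ y
  have hd := abs_phiTrunc_sub_le hτ x y
  set p := phiTrunc τ x
  set q := phiTrunc τ y
  have hp : 0 < p := (inv_pos.2 h0).trans_le hx1
  have hq : 0 < q := (inv_pos.2 h0).trans_le hy1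
  have hp' : p⁻¹ ≤ τ := inv_le_of_inv_le₀ h0 hx1
  have hq' : q⁻¹ ≤ τ := inv_le_of_inv_le₀ h0 hy1
  have hp0 : 0 < p⁻¹ := inv_pos.2 hp
  have hq0 : 0 < q⁻¹ := inv_pos.2 hq
  have ha : |p⁻¹ - q⁻¹| ≤ τ := abs_le.2 ⟨by linarith, by linarith⟩
  have hb : |p⁻¹ - q⁻¹| ≤ τ ^ 2 * |x - y| := by
    have : p⁻¹ - q⁻¹ = p⁻¹ * q⁻¹ * (q - p) := by field_simp
    rw [this, abs_mul, abs_of_pos (by positivity), abs_sub_comm q p, sq]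
    gcongr
  have hc : |p⁻¹ - q⁻¹| ≤ τ ^ 2 * min 1 |x - y| := by
    rcases min_cases 1 |x - y| with h | h
    · rw [h.1]; nlinarith
    · rw [h.1]; exact hb
  calc (p⁻¹ - q⁻¹) ^ 2 = |p⁻¹ - q⁻¹| * |p⁻¹ - q⁻¹| := by rw [← sq, sq_abs]
    _ ≤ τ * (τ ^ 2 * min 1 |x - y|) := by gcongr
    _ = _ := by ring

/-- The forgetting factor with the convention that the first one is `1`. -/
def initOne {Ω : Type*} (f : ℕ → Ω → ℝ) (j : ℕ) (ω : Ω) : ℝ := if j ≤ 1 then 1 else f j ω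

theorem xiSq_succ {Ω : Type*} (r f : ℕ → Ω → ℝ) (k : ℕ) (ω : Ω) :
    xiSq r f (k + 1) ω = 1 / ((k : ℝ) + 1) * initOne f (k + 1) ω * r (k + 1) ω ^ 2 +
      (1 - 1 / ((k : ℝ) + 1)) * xiSq r f k ω := by
  cases k with
  | zero => simp [xiSq, initOne]
  | succ k =>
    rw [xiSq]
    simp [initOne]
    ring

theorem mul_xiSq {Ω : Type*} (r f : ℕ → Ω → ℝ) (k : ℕ) (ω : Ω) :
    k * xiSq r f k ω = ∑ i ∈ Finset.range k, initOne f (i + 1) ω * r (i + 1) ω ^ 2 := by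
  induction k with
  | zero => simp
  | succ k ih =>
    rw [Finset.sum_range_succ, ← ih, xiSq_succ]
    push_cast
    field_simp
    ring

theorem xiSq_eq_average {Ω : Type*} (r f : ℕ → Ω → ℝ) (k : ℕ) (ω : Ω) :
    xiSq r f k ω = (∑ i ∈ Finset.range k, initOne f (i + 1) ω * r (i + 1) ω ^ 2) / k := by
  rcases Nat.eq_zero_or_pos k with rfl | hk
  · simp [xiSq]
  · rw [← mul_xiSq, mul_div_cancel_left₀]
    exact_mod_cast hk.ne'

/-! ### Upper bounds on conditional expectations -/

section CondLE

variable {Ω : Type*} {H K : MeasurableSpace Ω} [mΩ : MeasurableSpace Ω] {μ : Measure Ω}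
  [IsProbabilityMeasure μ]

/-- `Z` is integrable and `B` bounds its conditional expectation given `H`. -/
def CondLE (μ : Measure Ω) (H : MeasurableSpace Ω) (Z B : Ω → ℝ) : Prop :=
  Integrable Z μ ∧ ∀ᵐ ω ∂μ, (μ[Z | H]) ω ≤ B ω

theorem CondLE.congr_right {Z B B' : Ω → ℝ} (h : CondLE μ H Z B) (hB : ∀ᵐ ω ∂μ, B ω ≤ B' ω) :
    CondLE μ H Z B' :=
  ⟨h.1, by filter_upwards [h.2, hB] with ω h1 h2 using h1.trans h2⟩

theorem CondLE.mono {Z Z' B : Ω → ℝ} (h : CondLE μ H Z B) (hm : AEStronglyMeasurable Z' μ)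
    (h0 : ∀ᵐ ω ∂μ, 0 ≤ Z' ω) (hle : ∀ᵐ ω ∂μ, Z' ω ≤ Z ω) : CondLE μ H Z' B := by
  have hi : Integrable Z' μ := h.1.mono' hm (by
    filter_upwards [h0, hle] with ω h1 h2
    rwa [Real.norm_of_nonneg h1])
  refine ⟨hi, ?_⟩
  filter_upwards [h.2, condExp_mono (m := H) hi h.1 hle] with ω h1 h2 using h2.trans h1

theorem CondLE.add {Z Z' B B' : Ω → ℝ} (h : CondLE μ H Z B) (h' : CondLE μ H Z' B') :
    CondLE μ H (fun ω => Z ω + Z' ω) (fun ω => B ω + B' ω) := by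
  refine ⟨h.1.add h'.1, ?_⟩
  filter_upwards [h.2, h'.2, condExp_add h.1 h'.1 H] with ω h1 h2 h3
  refine (le_of_eq h3).trans (add_le_add h1 h2)

theorem CondLE.const (hH : H ≤ mΩ) (c : ℝ) : CondLE μ H (fun _ => c) (fun _ => c) :=
  ⟨integrable_const c, by rw [condExp_const hH]; simp⟩

theorem CondLE.sum {ι : Type*} (s : Finset ι) {Z B : ι → Ω → ℝ}
    (h : ∀ i ∈ s, CondLE μ H (Z i) (B i)) :
    CondLE μ H (fun ω => ∑ i ∈ s, Z i ω) (fun ω => ∑ i ∈ s, B i ω) := by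
  classical
  induction s using Finset.induction_on with
  | empty =>
    simp only [Finset.sum_empty]
    exact ⟨integrable_const 0, by
      have : (fun _ : Ω => (0 : ℝ)) = 0 := rfl
      rw [this, condExp_zero]; simp⟩
  | insert i s hi ih =>
    simp only [Finset.sum_insert hi]
    exact (h i (by simp)).add (ih fun j hj => h j (by simp [hj]))

theorem CondLE.mul_left {c Z B : Ω → ℝ} (h : CondLE μ H Z B) (hc : Measurable[H] c)
    (hc0 : ∀ ω, 0 ≤ c ω) (hi : Integrable (fun ω => c ω * Z ω) μ) :
    CondLE μ H (fun ω => c ω * Z ω) (fun ω => c ω * B ω) := by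
  refine ⟨hi, ?_⟩
  filter_upwards [h.2, condExp_mul_of_stronglyMeasurable_left hc.stronglyMeasurable hi h.1]
    with ω h1 h2
  refine (le_of_eq h2).trans ?_
  exact mul_le_mul_of_nonneg_left h1 (hc0 ω)

theorem CondLE.const_mul {Z B : Ω → ℝ} (h : CondLE μ H Z B) {c : ℝ} (hc : 0 ≤ c) :
    CondLE μ H (fun ω => c * Z ω) (fun ω => c * B ω) :=
  h.mul_left measurable_const (fun _ => hc) (h.1.const_mul c)

theorem CondLE.self {Z : Ω → ℝ} (hH : H ≤ mΩ) (hZ : Measurable[H] Z) (hi : Integrable Z μ) :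
    CondLE μ H Z Z :=
  ⟨hi, by rw [condExp_of_stronglyMeasurable hH hZ.stronglyMeasurable hi]; simp⟩

/-- A factor independent of `K ≥ H` averages out of a conditional expectation given `H`. -/
theorem condExp_mul_of_indep {a Z : Ω → ℝ} (hK : K ≤ mΩ) (hHK : H ≤ K)
    (ha : Measurable[K] a) (hZm : Measurable Z)
    (hind : Indep (MeasurableSpace.comap Z inferInstance) K μ)
    (hai : Integrable a μ) (hZ : Integrable Z μ) :
    Integrable (fun ω => a ω * Z ω) μ ∧
      ∀ᵐ ω ∂μ, (μ[fun ω => a ω * Z ω | H]) ω = (∫ ω, Z ω ∂μ) * (μ[a | H]) ω := by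
  have hif : IndepFun a Z μ := by
    rw [IndepFun_iff_Indep]
    exact (indep_of_indep_of_le_right hind ha.comap_le).symm
  have hi : Integrable (fun ω => a ω * Z ω) μ := hif.integrable_mul hai hZ
  refine ⟨hi, ?_⟩
  have h1 : μ[fun ω => a ω * Z ω | K] =ᵐ[μ] fun ω => (∫ ω, Z ω ∂μ) * a ω := by
    filter_upwards [condExp_mul_of_stronglyMeasurable_left ha.stronglyMeasurable hi hZ,
      condExp_indep_eq hZm.comap_le hK (comap_measurable Z).stronglyMeasurable hind] with ω h1 h2
    refine h1.trans ?_
    rw [Pi.mul_apply, h2, mul_comm]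
  have h2 := condExp_condExp_of_le (μ := μ) (f := fun ω => a ω * Z ω) hHK hK
  have h3 := condExp_smul (μ := μ) (∫ ω, Z ω ∂μ) a H
  filter_upwards [h2, condExp_congr_ae (m := H) h1, h3] with ω h2 h4 h3
  rw [← h2, h4]
  exact h3

theorem CondLE.mul_indep {a Z B : Ω → ℝ} (h : CondLE μ H a B) (hK : K ≤ mΩ) (hHK : H ≤ K)
    (ha : Measurable[K] a) (hZm : Measurable Z)
    (hind : Indep (MeasurableSpace.comap Z inferInstance) K μ)
    (hZ : Integrable Z μ) (hZ0 : ∀ ω, 0 ≤ Z ω) :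
    CondLE μ H (fun ω => a ω * Z ω) (fun ω => (∫ ω, Z ω ∂μ) * B ω) := by
  obtain ⟨h1, h2⟩ := condExp_mul_of_indep hK hHK ha hZm hind h.1 hZ
  refine ⟨h1, ?_⟩
  filter_upwards [h2, h.2] with ω h2 h3
  rw [h2]
  exact mul_le_mul_of_nonneg_left h3 (integral_nonneg hZ0)

theorem CondLE.of_indep {Z : Ω → ℝ} (hH : H ≤ mΩ) (hZm : Measurable Z)
    (hind : Indep (MeasurableSpace.comap Z inferInstance) H μ) (hZ : Integrable Z μ) :
    CondLE μ H Z (fun _ => ∫ ω, Z ω ∂μ) := by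
  refine ⟨hZ, ?_⟩
  filter_upwards [condExp_indep_eq hZm.comap_le hH (comap_measurable Z).stronglyMeasurable hind]
    with ω h using h.le

theorem CondLE.integral_indicator_le {Z B : Ω → ℝ} (h : CondLE μ H Z B) (hH : H ≤ mΩ)
    {A : Set Ω} (hA : MeasurableSet[H] A) (hB : Integrable B μ) :
    ∫ ω in A, Z ω ∂μ ≤ ∫ ω in A, B ω ∂μ := by
  rw [← setIntegral_condExp hH h.1 hA]
  exact setIntegral_mono_ae integrable_condExp.integrableOn hB.integrableOn h.2

end CondLE

/-! ### The abstract regression filtrations -/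

/-- The σ-algebra generated by `Z_1, Z_2, …`. -/
@[reducible] def seqSigma {Ω E : Type*} [MeasurableSpace E] (Z : ℕ → Ω → E) : MeasurableSpace Ω :=
  MeasurableSpace.comap (fun ω (i : ℕ) => Z (i + 1) ω) inferInstance

theorem measurable_seqSigma {Ω E : Type*} [MeasurableSpace E] (Z : ℕ → Ω → E) (i : ℕ) :
    Measurable[seqSigma Z] (Z (i + 1)) :=
  (measurable_pi_apply i).comp (comap_measurable (fun ω (i : ℕ) => Z (i + 1) ω))

/-- Adapted covariates `X` and noise `ε` along filtrations `F ≤ O`, where `ε_{i+1}` is independent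
of a σ-algebra `K i` containing `O i` and all covariates, and `X_{i+1}` is independent of `O i`. -/
structure IsRegressionFlow {Ω : Type*} [mΩ : MeasurableSpace Ω] (μ : Measure Ω) {n : ℕ}
    (X : ℕ → Ω → (Fin n → ℝ)) (ε : ℕ → Ω → ℝ) (σ : ℝ)
    (F O : Filtration ℕ mΩ) (K : ℕ → MeasurableSpace Ω) : Prop where
  F_le_O : ∀ i, F i ≤ O i
  O_le_K : ∀ i, O i ≤ K i
  F_le_K : ∀ N i, F N ≤ K i
  K_le : ∀ i, K i ≤ mΩ
  meas_X : ∀ i, Measurable[F (i + 1)] (X (i + 1))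
  meas_ε : ∀ i, Measurable[O (i + 1)] (ε (i + 1))
  indep_ε : ∀ i, Indep (MeasurableSpace.comap (ε (i + 1)) inferInstance) (K i) μ
  indep_X : ∀ i, Indep (MeasurableSpace.comap (X (i + 1)) inferInstance) (O i) μ
  iIndep_X : iIndepFun (fun i : ℕ => X (i + 1)) μ
  iIndep_ε : iIndepFun (fun i : ℕ => ε (i + 1)) μ
  indep_ε_F : ∀ N, Indep (seqSigma ε) (F N) μ
  ident_X : ∀ i, IdentDistrib (X (i + 1)) (X 1) μ μ
  ident_ε : ∀ i, IdentDistrib (ε (i + 1)) (ε 1) μ μ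
  memLp_ε : MemLp (ε 1) 2 μ
  mean_ε : ∫ ω, ε 1 ω ∂μ = 0
  sq_ε : ∫ ω, ε 1 ω ^ 2 ∂μ = σ ^ 2
  sq_X : Integrable (fun ω => X 1 ω ⬝ᵥ X 1 ω) μ

namespace IsRegressionFlow

variable {Ω : Type*} [mΩ : MeasurableSpace Ω] {μ : Measure Ω}
  [IsProbabilityMeasure μ] {n : ℕ}
  {X : ℕ → Ω → (Fin n → ℝ)} {ε : ℕ → Ω → ℝ} {σ : ℝ}
  {F O : Filtration ℕ mΩ} {K : ℕ → MeasurableSpace Ω}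

theorem measurable_X_of_lt (h : IsRegressionFlow μ X ε σ F O K) {i N : ℕ} (hi : i < N) :
    Measurable[F N] (X (i + 1)) := (h.meas_X i).mono (F.mono hi) le_rfl

theorem measurable_ε_of_lt (h : IsRegressionFlow μ X ε σ F O K) {i N : ℕ} (hi : i < N) :
    Measurable[O N] (ε (i + 1)) := (h.meas_ε i).mono (O.mono hi) le_rfl

theorem measurable_ε (h : IsRegressionFlow μ X ε σ F O K) (i : ℕ) : Measurable (ε (i + 1)) :=
  (h.meas_ε i).mono (O.le _) le_rfl

theorem measurable_X (h : IsRegressionFlow μ X ε σ F O K) (i : ℕ) : Measurable (X (i + 1)) :=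
  (h.meas_X i).mono (F.le _) le_rfl

theorem memLp_ε' (h : IsRegressionFlow μ X ε σ F O K) (i : ℕ) : MemLp (ε (i + 1)) 2 μ :=
  (h.ident_ε i).memLp_iff.2 h.memLp_ε

theorem integrable_ε (h : IsRegressionFlow μ X ε σ F O K) (i : ℕ) : Integrable (ε (i + 1)) μ :=
  (h.memLp_ε' i).integrable one_le_two

theorem integrable_ε_sq (h : IsRegressionFlow μ X ε σ F O K) (i : ℕ) :
    Integrable (fun ω => ε (i + 1) ω ^ 2) μ := (h.memLp_ε' i).integrable_sq

theorem integral_ε (h : IsRegressionFlow μ X ε σ F O K) (i : ℕ) : ∫ ω, ε (i + 1) ω ∂μ = 0 := by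
  rw [(h.ident_ε i).integral_eq, h.mean_ε]

theorem integral_ε_sq (h : IsRegressionFlow μ X ε σ F O K) (i : ℕ) :
    ∫ ω, ε (i + 1) ω ^ 2 ∂μ = σ ^ 2 := by
  rw [← h.sq_ε]
  exact ((h.ident_ε i).comp (measurable_id.pow_const 2)).integral_eq

theorem measurable_dot : Measurable fun x : Fin n → ℝ => x ⬝ᵥ x := by
  unfold dotProduct; fun_prop

theorem integrable_X_sq (h : IsRegressionFlow μ X ε σ F O K) (i : ℕ) :
    Integrable (fun ω => X (i + 1) ω ⬝ᵥ X (i + 1) ω) μ :=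
  ((h.ident_X i).comp measurable_dot).integrable_iff.2 h.sq_X

theorem indep_comp_ε (h : IsRegressionFlow μ X ε σ F O K) (i : ℕ) {φ : ℝ → ℝ}
    (hφ : Measurable φ) :
    Indep (MeasurableSpace.comap (fun ω => φ (ε (i + 1) ω)) inferInstance) (K i) μ :=
  indep_of_indep_of_le_left (h.indep_ε i)
    (hφ.comp (comap_measurable (ε (i + 1)))).comap_le

/-- Weighted squared noise, with a `K i`-measurable weight. -/
theorem condLE_mul_ε_sq (h : IsRegressionFlow μ X ε σ F O K) (i N : ℕ) {a B : Ω → ℝ}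
    (ha : CondLE μ (F N) a B) (ham : Measurable[K i] a) :
    CondLE μ (F N) (fun ω => a ω * ε (i + 1) ω ^ 2) (fun ω => σ ^ 2 * B ω) := by
  rw [← h.integral_ε_sq i]
  exact ha.mul_indep (h.K_le i) (h.F_le_K N i) ham ((h.measurable_ε i).pow_const 2)
    (h.indep_comp_ε i (φ := fun x => x ^ 2) (by fun_prop)) (h.integrable_ε_sq i)
    fun ω => sq_nonneg _

theorem condLE_mul_ε (h : IsRegressionFlow μ X ε σ F O K) (i N : ℕ) {a : Ω → ℝ}
    (ha : Integrable a μ) (ham : Measurable[K i] a) :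
    CondLE μ (F N) (fun ω => a ω * ε (i + 1) ω) (fun _ => 0) := by
  obtain ⟨h1, h2⟩ := condExp_mul_of_indep (h.K_le i) (h.F_le_K N i) ham (h.measurable_ε i)
    (h.indep_ε i) ha (h.integrable_ε i)
  refine ⟨h1, ?_⟩
  filter_upwards [h2] with ω h2
  rw [h2, h.integral_ε, zero_mul]

end IsRegressionFlow

/-! ### The flow of the linear model -/

section Flow

/-- If `m₁ ⊥ m₂` and `m₁ ⊔ m₂ ⊥ m₃`, then `m₁ ⊥ m₂ ⊔ m₃`. -/
theorem indep_sup_right_of_indep_sup_left {Ω : Type*} {m₁ m₂ m₃ : MeasurableSpace Ω}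
    [mΩ : MeasurableSpace Ω] {μ : Measure Ω} [IsProbabilityMeasure μ]
    (h₁ : m₁ ≤ mΩ) (h₂ : m₂ ≤ mΩ) (h₃ : m₃ ≤ mΩ)
    (h12 : Indep m₁ m₂ μ) (h123 : Indep (m₁ ⊔ m₂) m₃ μ) : Indep m₁ (m₂ ⊔ m₃) μ := by
  let p : Set (Set Ω) := {u | ∃ s t, MeasurableSet[m₂] s ∧ MeasurableSet[m₃] t ∧ s ∩ t = u}
  refine IndepSets.indep h₁ (sup_le h₂ h₃) (p1 := {s | MeasurableSet[m₁] s}) (p2 := p)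
    (@MeasurableSpace.isPiSystem_measurableSet _ m₁) ?_
    (@MeasurableSpace.generateFrom_measurableSet _ m₁).symm ?_ ?_
  · rintro _ ⟨s, t, hs, ht, rfl⟩ _ ⟨s', t', hs', ht', rfl⟩ _
    exact ⟨s ∩ s', t ∩ t', @MeasurableSet.inter _ m₂ _ _ hs hs', @MeasurableSet.inter _ m₃ _ _ ht ht',
      Set.inter_inter_inter_comm _ _ _ _⟩
  · refine le_antisymm (sup_le (fun s hs => ?_) fun t ht => ?_) ?_
    · exact MeasurableSpace.measurableSet_generateFrom
        ⟨s, Set.univ, hs, @MeasurableSet.univ _ m₃, Set.inter_univ _⟩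
    · exact MeasurableSpace.measurableSet_generateFrom
        ⟨Set.univ, t, @MeasurableSet.univ _ m₂, ht, Set.univ_inter _⟩
    · refine MeasurableSpace.generateFrom_le ?_
      rintro _ ⟨s, t, hs, ht, rfl⟩
      exact @MeasurableSet.inter _ (m₂ ⊔ m₃) _ _ (le_sup_left (a := m₂) (b := m₃) s hs)
        (le_sup_right (a := m₂) (b := m₃) t ht)
  · rw [IndepSets_iff]
    rintro r _ hr ⟨s, t, hs, ht, rfl⟩
    have hr' : MeasurableSet[m₁ ⊔ m₂] r := le_sup_left (a := m₁) (b := m₂) r hr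
    have hs' : MeasurableSet[m₁ ⊔ m₂] s := le_sup_right (a := m₁) (b := m₂) s hs
    rw [Indep_iff] at h12 h123
    rw [← Set.inter_assoc, h123 _ _ (@MeasurableSet.inter _ (m₁ ⊔ m₂) _ _ hr' hs') ht,
      h12 _ _ hr hs, h123 _ _ hs' ht, mul_assoc]

theorem sigmaUpTo_le {Ω : Type*} {m : MeasurableSpace Ω} [MeasurableSpace Ω]
    {E : Type*} [MeasurableSpace E] {Z : ℕ → Ω → E}
    (hZ : ∀ i, 1 ≤ i → Measurable (Z i)) {k : ℕ}
    (h : ∀ i, 1 ≤ i → i ≤ k → Measurable[m] (Z i)) : sigmaUpTo Z hZ k ≤ m :=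
  iSup₂_le fun j hj => (h j hj.1 hj.2).comap_le

variable {Ω : Type*} [mΩ : MeasurableSpace Ω] {μ : Measure Ω} [IsProbabilityMeasure μ]

theorem seqSigma_le {E : Type*} [MeasurableSpace E] {Z : ℕ → Ω → E}
    (hZ : ∀ i, 1 ≤ i → Measurable (Z i)) : seqSigma Z ≤ mΩ :=
  Measurable.comap_le
    (measurable_pi_lambda (fun ω (i : ℕ) => Z (i + 1) ω) fun i => hZ (i + 1) (by omega))

theorem measurable_sigmaUpTo {E : Type*} [MeasurableSpace E] {Z : ℕ → Ω → E}
    (hZ : ∀ i, 1 ≤ i → Measurable (Z i)) {i k : ℕ} (hi : 1 ≤ i) (hik : i ≤ k) :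
    Measurable[sigmaUpTo Z hZ k] (Z i) :=
  (comap_measurable (Z i)).mono
    (le_iSup₂_of_le (f := fun j (_ : j ∈ Set.Icc 1 k) => MeasurableSpace.comap (Z j) _)
      i ⟨hi, hik⟩ le_rfl) le_rfl

theorem indep_comap_sigmaUpTo {E : Type*} [MeasurableSpace E] {Z : ℕ → Ω → E}
    (hZ : ∀ i, 1 ≤ i → Measurable (Z i)) (hind : iIndepFun (fun i : ℕ => Z (i + 1)) μ) (i : ℕ) :
    Indep (MeasurableSpace.comap (Z (i + 1)) inferInstance) (sigmaUpTo Z hZ i) μ := by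
  have h := indep_iSup_of_disjoint (fun j => (hZ (j + 1) (by omega)).comap_le) hind.iIndep
    (S := {i}) (T := Set.Iio i) (by simp)
  refine indep_of_indep_of_le_left (indep_of_indep_of_le_right h ?_) ?_
  · refine sigmaUpTo_le hZ fun j hj hji => ?_
    obtain ⟨j, rfl⟩ : ∃ j', j = j' + 1 := ⟨j - 1, by omega⟩
    exact (comap_measurable (Z (j + 1))).mono (le_iSup₂_of_le
      (f := fun l (_ : l ∈ Set.Iio i) => MeasurableSpace.comap (Z (l + 1)) _)
      j (by simp; omega) le_rfl) le_rfl
  · exact le_iSup₂_of_le (f := fun l (_ : l ∈ ({i} : Set ℕ)) =>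
      MeasurableSpace.comap (Z (l + 1)) _) i (by simp) le_rfl

theorem IsLinearModel.isRegressionFlow {n : ℕ} {X : ℕ → Ω → (Fin n → ℝ)} {Y ε : ℕ → Ω → ℝ}
    {βstar : Fin n → ℝ} {σ : ℝ} (hX : ∀ i, 1 ≤ i → Measurable (X i))
    (hY : ∀ i, 1 ≤ i → Measurable (Y i)) (h : IsLinearModel μ X Y ε βstar σ)
    (hL2 : Integrable (fun ω => X 1 ω ⬝ᵥ X 1 ω) μ) :
    ∃ K, IsRegressionFlow μ X ε σ (sigmaUpTo X hX)
      (sigmaUpTo (fun i ω => (X i ω, Y i ω)) (fun i hi => (hX i hi).prodMk (hY i hi))) K := by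
  have hdot : Measurable fun x : Fin n → ℝ => x ⬝ᵥ βstar := by unfold dotProduct; fun_prop
  have hε_eq : ∀ i, 1 ≤ i → ε i = fun ω => Y i ω - X i ω ⬝ᵥ βstar := fun i hi => by
    ext ω; rw [h.model i hi ω]; ring
  have hε : ∀ i, 1 ≤ i → Measurable (ε i) := fun i hi => by
    rw [hε_eq i hi]; exact (hY i hi).sub (hdot.comp (hX i hi))
  set O := sigmaUpTo (fun i ω => (X i ω, Y i ω)) (fun i hi => (hX i hi).prodMk (hY i hi)) with hO
  have hOX : ∀ i k, 1 ≤ i → i ≤ k → Measurable[O k] (X i) := fun i k h1 h2 =>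
    measurable_fst.comp (measurable_sigmaUpTo (Z := fun i ω => (X i ω, Y i ω)) _ h1 h2)
  have hOY : ∀ i k, 1 ≤ i → i ≤ k → Measurable[O k] (Y i) := fun i k h1 h2 =>
    measurable_snd.comp (measurable_sigmaUpTo (Z := fun i ω => (X i ω, Y i ω)) _ h1 h2)
  refine ⟨fun i => sigmaUpTo ε hε i ⊔ seqSigma X, ?_⟩
  have hKX : ∀ i j, 1 ≤ j → Measurable[sigmaUpTo ε hε i ⊔ seqSigma X] (X j) := fun i j hj => by
    obtain ⟨j, rfl⟩ : ∃ j', j = j' + 1 := ⟨j - 1, by omega⟩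
    exact (measurable_seqSigma X j).mono le_sup_right le_rfl
  refine
    { F_le_O := fun i => sigmaUpTo_le hX fun j h1 h2 => hOX j i h1 h2
      O_le_K := fun i => sigmaUpTo_le _ fun j h1 h2 => ?_
      F_le_K := fun N i => sigmaUpTo_le hX fun j h1 h2 => hKX i j h1
      K_le := fun i => sup_le ((sigmaUpTo ε hε).le i) (seqSigma_le hX)
      meas_X := fun i => measurable_sigmaUpTo hX (by omega) le_rfl
      meas_ε := fun i => ?_
      indep_ε := fun i => ?_
      indep_X := fun i => ?_
      iIndep_X := h.iIndep_obs.comp (fun _ => Prod.fst) fun _ => measurable_fst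
      iIndep_ε := h.iIndep_noise
      indep_ε_F := fun N => indep_of_indep_of_le_right
        ((IndepFun_iff_Indep _ _ _).1 h.indep_noise_cov) (sigmaUpTo_le hX fun j h1 _ => ?_)
      ident_X := fun i => (h.identDistrib_obs (i + 1) (by omega)).comp measurable_fst
      ident_ε := fun i => h.identDistrib_noise (i + 1) (by omega)
      memLp_ε := h.memLp_noise
      mean_ε := h.mean_noise
      sq_ε := ?_
      sq_X := hL2 }
  · refine @Measurable.prodMk _ _ _ _ _ (_) _ _ (hKX i j h1) ?_
    have hεj : Measurable[sigmaUpTo ε hε i ⊔ seqSigma X] (ε j) :=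
      (measurable_sigmaUpTo hε h1 h2).mono le_sup_left le_rfl
    have : Y j = fun ω => X j ω ⬝ᵥ βstar + ε j ω := funext fun ω => h.model j h1 ω
    rw [this]
    exact @Measurable.add _ _ _ _ _ (_) _ _ (hdot.comp (hKX i j h1)) hεj
  · rw [hε_eq (i + 1) (by omega)]
    exact @Measurable.sub _ _ _ _ _ (_) _ _ (hOY _ _ (by omega) le_rfl)
      (hdot.comp (hOX _ _ (by omega) le_rfl))
  · refine indep_sup_right_of_indep_sup_left (hε (i + 1) (by omega)).comap_le
      ((sigmaUpTo ε hε).le i) (seqSigma_le hX) (indep_comap_sigmaUpTo hε h.iIndep_noise i) ?_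
    have h1 := (IndepFun_iff_Indep _ _ _).1 h.indep_noise_cov
    refine indep_of_indep_of_le_left h1 (sup_le (measurable_seqSigma ε i).comap_le (sigmaUpTo_le hε fun j h1 _ => ?_))
    obtain ⟨j, rfl⟩ : ∃ j', j = j' + 1 := ⟨j - 1, by omega⟩
    exact measurable_seqSigma ε j
  · exact indep_of_indep_of_le_left (indep_comap_sigmaUpTo
      (Z := fun i ω => (X i ω, Y i ω)) (fun i hi => (hX i hi).prodMk (hY i hi)) h.iIndep_obs i)
      (measurable_fst.comp (comap_measurable (fun ω => (X (i + 1) ω, Y (i + 1) ω)))).comap_le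
  · obtain ⟨j, rfl⟩ : ∃ j', j = j' + 1 := ⟨j - 1, by omega⟩
    exact measurable_seqSigma X j
  · rw [← h.variance_noise, variance_of_integral_eq_zero
      h.memLp_noise.aestronglyMeasurable.aemeasurable h.mean_noise]

end Flow

/-! ### Coercivity of the information matrix -/

section Coercivity

variable {Ω : Type*} [mΩ : MeasurableSpace Ω] {μ : Measure Ω} [IsProbabilityMeasure μ]

/-- Chernoff bound for the number of visits of an i.i.d. sequence to a set of positive measure. -/
theorem exists_visit_count_bound {E : Type*} [MeasurableSpace E] {X : ℕ → Ω → E}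
    (hX : ∀ i, Measurable (X (i + 1))) (hind : iIndepFun (fun i : ℕ => X (i + 1)) μ)
    (hident : ∀ i, IdentDistrib (X (i + 1)) (X 1) μ μ) {S : Set E} (hS : MeasurableSet S)
    (hpos : μ (X 1 ⁻¹' S) ≠ 0) :
    ∃ p > 0, ∃ q, 0 ≤ q ∧ q < 1 ∧ ∀ m : ℕ,
      μ.real {ω | ∑ i ∈ Finset.range m, S.indicator (fun _ => (1 : ℝ)) (X (i + 1) ω) ≤ p * m}
        ≤ q ^ m := by
  let φ : E → ℝ := S.indicator fun _ => 1
  have hφ : Measurable φ := measurable_const.indicator hS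
  let Z : ℕ → Ω → ℝ := fun i ω => φ (X (i + 1) ω)
  have hZ : ∀ i, Measurable (Z i) := fun i => hφ.comp (hX i)
  have hφ01 : ∀ x, 0 ≤ φ x := fun x => Set.indicator_nonneg (fun _ _ => zero_le_one) x
  have hZind : iIndepFun Z μ := hind.comp (fun _ => φ) fun _ => hφ
  set ρ := mgf (Z 0) μ (-1) with hρ
  have hint : ∀ (W : Ω → ℝ), Measurable W → (∀ ω, 0 ≤ W ω) →
      Integrable (fun ω => Real.exp (-1 * W ω)) μ := fun W hW hW0 => by
    refine Integrable.of_bound (by fun_prop) 1 (ae_of_all _ fun ω => ?_)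
    rw [Real.norm_of_nonneg (Real.exp_pos _).le, Real.exp_le_one_iff]
    linarith [hW0 ω]
  have hρpos : 0 < ρ := mgf_pos (hint _ (hZ 0) fun ω => hφ01 _)
  have hρlt : ρ < 1 := by
    have hr : 0 < μ.real (X 1 ⁻¹' S) := ENNReal.toReal_pos hpos (measure_ne_top _ _)
    have h1 : ρ = 1 - (1 - Real.exp (-1)) * μ.real (X 1 ⁻¹' S) := by
      have h2 : (fun ω => Real.exp (-1 * Z 0 ω)) =
          fun ω => 1 - (1 - Real.exp (-1)) * (X 1 ⁻¹' S).indicator (fun _ => (1 : ℝ)) ω := by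
        ext ω
        by_cases hω : X 1 ω ∈ S
        · simp [Z, φ, hω]
        · simp [Z, φ, hω]
      have hSm : MeasurableSet (X 1 ⁻¹' S) := hX 0 hS
      rw [hρ, mgf, h2, integral_sub (integrable_const _)
        (((integrable_const _).indicator hSm).const_mul _), integral_const_mul,
        integral_indicator hSm]
      simp
    have h3 : Real.exp (-1) < 1 := by rw [Real.exp_lt_one_iff]; norm_num
    rw [h1]
    nlinarith
  have hmgf : ∀ i, mgf (Z i) μ (-1) = ρ := fun i =>
    (((hident i).comp hφ).comp (u := fun x => Real.exp (-1 * x)) (by fun_prop)).integral_eq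
  refine ⟨-Real.log ρ / 2, by linarith [Real.log_neg hρpos hρlt], Real.exp (-Real.log ρ / 2) * ρ,
    by positivity, ?_, fun m => ?_⟩
  · calc Real.exp (-Real.log ρ / 2) * ρ = Real.exp (-Real.log ρ / 2) * Real.exp (Real.log ρ) := by
          rw [Real.exp_log hρpos]
      _ = Real.exp (Real.log ρ / 2) := by rw [← Real.exp_add]; congr 1; ring
      _ < 1 := by rw [Real.exp_lt_one_iff]; linarith [Real.log_neg hρpos hρlt]
  · have h1 := measure_le_le_exp_mul_mgf (μ := μ) (X := ∑ i ∈ Finset.range m, Z i) (t := -1)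
      (-Real.log ρ / 2 * m) (by norm_num)
      (hint _ (by rw [Finset.sum_fn]; exact Finset.measurable_sum _ fun i _ => hZ i)
        fun ω => by rw [Finset.sum_apply]; exact Finset.sum_nonneg fun i _ => hφ01 _)
    rw [hZind.mgf_sum hZ, Finset.prod_congr rfl fun i _ => hmgf i] at h1
    simp only [Finset.sum_apply, Finset.prod_const, Finset.card_range] at h1
    refine h1.trans (le_of_eq ?_)
    rw [mul_pow, ← Real.exp_nat_mul]
    congr 2
    ring

/-- On sets of directions `S`: outside rare events, the information grows linearly. -/
def HasInfoGrowth (μ : Measure Ω) {n : ℕ} (X : ℕ → Ω → (Fin n → ℝ)) (F : Filtration ℕ mΩ)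
    (S : Set (Fin n → ℝ)) : Prop :=
  ∃ a > 0, ∃ bad : ℕ → Set Ω, (∀ m, MeasurableSet[F m] (bad m)) ∧
    Summable (fun m : ℕ => (m : ℝ) * μ.real (bad m)) ∧
    ∀ m ω, ω ∉ bad m → ∀ u ∈ S, a * m ≤ ∑ i ∈ Finset.range m, (X (i + 1) ω ⬝ᵥ u) ^ 2

variable {n : ℕ} {X : ℕ → Ω → (Fin n → ℝ)} {F : Filtration ℕ mΩ}

theorem HasInfoGrowth.union {S T : Set (Fin n → ℝ)} (hS : HasInfoGrowth μ X F S)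
    (hT : HasInfoGrowth μ X F T) : HasInfoGrowth μ X F (S ∪ T) := by
  obtain ⟨a, ha, b, hb, hbs, h⟩ := hS
  obtain ⟨a', ha', b', hb', hbs', h'⟩ := hT
  refine ⟨min a a', lt_min ha ha', fun m => b m ∪ b' m,
    fun m => @MeasurableSet.union _ (F m) _ _ (hb m) (hb' m), ?_, ?_⟩
  · refine Summable.of_nonneg_of_le (fun m => by positivity) (fun m => ?_) (hbs.add hbs')
    rw [← mul_add]
    exact mul_le_mul_of_nonneg_left (measureReal_union_le _ _) (Nat.cast_nonneg _)
  · rintro m ω hω u (hu | hu)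
    · refine le_trans ?_ (h m ω (fun hh => hω (Or.inl hh)) u hu)
      gcongr; exact min_le_left _ _
    · refine le_trans ?_ (h' m ω (fun hh => hω (Or.inr hh)) u hu)
      gcongr; exact min_le_right _ _

theorem hasInfoGrowth_nhds (hX : ∀ i, Measurable[F (i + 1)] (X (i + 1)))
    (hind : iIndepFun (fun i : ℕ => X (i + 1)) μ)
    (hident : ∀ i, IdentDistrib (X (i + 1)) (X 1) μ μ) (v : Fin n → ℝ)
    (hv : μ {ω | |X 1 ω ⬝ᵥ v| = 0} < 1) :
    ∃ t ∈ 𝓝 v, HasInfoGrowth μ X F t := by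
  have hXm : ∀ i, Measurable (X (i + 1)) := fun i => (hX i).mono (F.le _) le_rfl
  have hdv : Measurable fun x : Fin n → ℝ => x ⬝ᵥ v := by unfold dotProduct; fun_prop
  have hdd : Measurable fun x : Fin n → ℝ => x ⬝ᵥ x := by unfold dotProduct; fun_prop
  let S : ℕ → Set (Fin n → ℝ) := fun k => {x | 2 / ((k : ℝ) + 1) < |x ⬝ᵥ v| ∧ x ⬝ᵥ x ≤ k}
  have hSm : ∀ k, MeasurableSet (S k) := fun k =>
    (measurableSet_lt measurable_const hdv.abs).inter (measurableSet_le hdd measurable_const)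
  obtain ⟨k, hk⟩ : ∃ k, μ (X 1 ⁻¹' S k) ≠ 0 := by
    by_contra! hcon
    have h0 := measure_iUnion_null hcon
    have h1 : {ω | |X 1 ω ⬝ᵥ v| = 0}ᶜ ⊆ ⋃ k, X 1 ⁻¹' S k := by
      intro ω hω
      have hpos : 0 < |X 1 ω ⬝ᵥ v| := lt_of_le_of_ne (abs_nonneg _) (Ne.symm hω)
      obtain ⟨k₁, hk₁⟩ := exists_nat_gt (2 / |X 1 ω ⬝ᵥ v|)
      obtain ⟨k₂, hk₂⟩ := exists_nat_gt (X 1 ω ⬝ᵥ X 1 ω)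
      refine Set.mem_iUnion.2 ⟨max k₁ k₂, ?_, ?_⟩
      · rw [div_lt_iff₀ (by positivity)]
        rw [div_lt_iff₀ hpos] at hk₁
        have : (k₁ : ℝ) ≤ (max k₁ k₂ : ℕ) := by exact_mod_cast le_max_left _ _
        nlinarith
      · exact hk₂.le.trans (by exact_mod_cast le_max_right _ _)
    have h2 : μ {ω | |X 1 ω ⬝ᵥ v| = 0} = 1 :=
      (prob_compl_eq_zero_iff (measurableSet_eq_fun (hdv.comp (hXm 0)).abs measurable_const)).1
        (measure_mono_null h1 h0)
    exact hv.ne h2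
  obtain ⟨p, hp, q, hq0, hq1, hq⟩ := exists_visit_count_bound hXm hind hident (hSm k) hk
  set c : ℝ := 1 / ((k : ℝ) + 1) with hc
  have hcpos : 0 < c := by positivity
  have hcont : Continuous fun u : Fin n → ℝ => (u - v) ⬝ᵥ (u - v) := by
    unfold dotProduct; fun_prop
  refine ⟨{u | k * ((u - v) ⬝ᵥ (u - v)) < c ^ 2}, ?_, c ^ 2 * p, by positivity,
    fun m => {ω | ∑ i ∈ Finset.range m, (S k).indicator (fun _ => (1 : ℝ)) (X (i + 1) ω) ≤ p * m},
    fun m => ?_, ?_, ?_⟩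
  · exact (isOpen_lt (continuous_const.mul hcont) continuous_const).mem_nhds (by simp [hcpos])
  · have hm : Measurable[F m] fun ω => ∑ i ∈ Finset.range m,
        (S k).indicator (fun _ => (1 : ℝ)) (X (i + 1) ω) := by
      refine Finset.measurable_sum _ fun i hi => ?_
      exact (measurable_const.indicator (hSm k)).comp
        ((hX i).mono (F.mono (Finset.mem_range.1 hi)) le_rfl)
    exact hm measurableSet_Iic
  · refine Summable.of_nonneg_of_le (fun m => by positivity) (fun m =>
      mul_le_mul_of_nonneg_left (hq m) (Nat.cast_nonneg _)) ?_
    simpa using summable_pow_mul_geometric_of_norm_lt_one 1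
      (by rwa [Real.norm_of_nonneg hq0] : ‖q‖ < 1)
  · intro m ω hω u hu
    simp only [Set.mem_ofPred_eq, not_le] at hω hu
    calc c ^ 2 * p * m ≤ c ^ 2 * ∑ i ∈ Finset.range m,
          (S k).indicator (fun _ => (1 : ℝ)) (X (i + 1) ω) := by
          rw [mul_assoc]; gcongr
      _ ≤ _ := by
          rw [Finset.mul_sum]
          refine Finset.sum_le_sum fun i _ => ?_
          by_cases hx : X (i + 1) ω ∈ S k
          · rw [Set.indicator_of_mem hx, mul_one]
            obtain ⟨hx1, hx2⟩ := hx
            set x := X (i + 1) ω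
            have h1 : (x ⬝ᵥ (u - v)) ^ 2 ≤ c ^ 2 := by
              refine (dotProduct_sq_le _ _).trans (le_trans ?_ hu.le)
              exact mul_le_mul_of_nonneg_right hx2 (dotProduct_self_nonneg' _)
            have h2 : |x ⬝ᵥ (u - v)| ≤ c := abs_le_of_sq_le_sq h1 hcpos.le
            have h3 : 2 * c < |x ⬝ᵥ v| := by rw [hc]; convert hx1 using 1; ring
            have h4 : c ≤ |x ⬝ᵥ u| := by
              have : x ⬝ᵥ v = x ⬝ᵥ u - x ⬝ᵥ (u - v) := by rw [dotProduct_sub]; ring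
              rw [this] at h3
              linarith [abs_sub (x ⬝ᵥ u) (x ⬝ᵥ (u - v))]
            rw [← sq_abs (x ⬝ᵥ u)]
            gcongr
          · rw [Set.indicator_of_notMem hx, mul_zero]
            positivity

theorem hasInfoGrowth_sphere (hX : ∀ i, Measurable[F (i + 1)] (X (i + 1)))
    (hind : iIndepFun (fun i : ℕ => X (i + 1)) μ)
    (hident : ∀ i, IdentDistrib (X (i + 1)) (X 1) μ μ)
    (hspan : ∀ v : Fin n → ℝ, v ⬝ᵥ v = 1 → μ {ω | |X 1 ω ⬝ᵥ v| = 0} < 1) :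
    HasInfoGrowth μ X F {v | v ⬝ᵥ v = 1} := by
  have hcont : Continuous fun u : Fin n → ℝ => u ⬝ᵥ u := by unfold dotProduct; fun_prop
  have hcpt : IsCompact {v : Fin n → ℝ | v ⬝ᵥ v = 1} := by
    refine (isCompact_closedBall (0 : Fin n → ℝ) 1).of_isClosed_subset
      (isClosed_eq hcont continuous_const) fun v hv => ?_
    rw [mem_closedBall_zero_iff, pi_norm_le_iff_of_nonneg zero_le_one]
    intro i
    rw [Real.norm_eq_abs]
    refine abs_le_of_sq_le_sq ?_ zero_le_one
    rw [one_pow, ← (show v ⬝ᵥ v = 1 from hv), sq]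
    exact Finset.single_le_sum (f := fun i => v i * v i) (fun i _ => mul_self_nonneg _)
      (Finset.mem_univ i)
  refine hcpt.induction_on ?_ ?_ ?_ ?_
  · exact ⟨1, one_pos, fun _ => ∅, fun m => @MeasurableSet.empty _ (F m), by simp [summable_zero],
      fun m ω _ u hu => absurd hu (Set.notMem_empty u)⟩
  · rintro S T hST ⟨a, ha, b, hb, hbs, h⟩
    exact ⟨a, ha, b, hb, hbs, fun m ω hω u hu => h m ω hω u (hST hu)⟩
  · exact fun S T hS hT => hS.union hT
  · intro v hv
    obtain ⟨t, ht, h⟩ := hasInfoGrowth_nhds (F := F) hX hind hident v (hspan v hv)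
    exact ⟨t, mem_nhdsWithin_of_mem_nhds ht, h⟩

/-- A predictable control `κ` of the inverse information, of order `1 / m`. -/
theorem exists_inverse_info_control (hX : ∀ i, Measurable[F (i + 1)] (X (i + 1)))
    (hind : iIndepFun (fun i : ℕ => X (i + 1)) μ)
    (hident : ∀ i, IdentDistrib (X (i + 1)) (X 1) μ μ)
    (hspan : ∀ v : Fin n → ℝ, v ⬝ᵥ v = 1 → μ {ω | |X 1 ω ⬝ᵥ v| = 0} < 1) {D : ℝ} (hD : 0 < D) :
    ∃ (κ : ℕ → Ω → ℝ) (W : Ω → ℝ), (∀ m, Measurable[F m] (κ m)) ∧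
      (∀ m ω, 0 ≤ κ m ω ∧ κ m ω ≤ 1) ∧ Integrable W μ ∧ (∀ᵐ ω ∂μ, ∀ m : ℕ, m * κ m ω ≤ W ω) ∧
      ∀ m ω u, u ⬝ᵥ u ≤ κ m ω *
        (u ⬝ᵥ u + ∑ i ∈ Finset.range m, (X (i + 1) ω ⬝ᵥ u) ^ 2 / D) := by
  classical
  obtain ⟨a, ha, bad, hbad, hsum, hgrow⟩ := hasInfoGrowth_sphere (F := F) hX hind hident hspan
  have hbad' : ∀ m, MeasurableSet (bad m) := fun m => F.le m _ (hbad m)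
  let κ : ℕ → Ω → ℝ := fun m ω => if ω ∈ bad m then 1 else (1 + a / D * m)⁻¹
  have hpos : ∀ m : ℕ, 1 ≤ 1 + a / D * m := fun m => by
    have : 0 ≤ a / D * m := by positivity
    linarith
  let w : Ω → ENNReal := fun ω => ∑' m : ℕ, (bad m).indicator (fun _ => (m : ENNReal)) ω
  have hwint : ∫⁻ ω, w ω ∂μ ≠ ⊤ := by
    have h1 : ∫⁻ ω, w ω ∂μ = ∑' m : ℕ, ENNReal.ofReal (m * μ.real (bad m)) := by
      rw [lintegral_tsum fun m => (measurable_const.indicator (hbad' m)).aemeasurable]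
      refine tsum_congr fun m => ?_
      rw [lintegral_indicator_const (hbad' m), ENNReal.ofReal_mul (Nat.cast_nonneg _)]
      simp
    rw [h1]
    exact hsum.tsum_ofReal_ne_top
  have hwm : Measurable w := Measurable.tsum fun m => measurable_const.indicator (hbad' m)
  refine ⟨κ, fun ω => D / a + (w ω).toReal, fun m => ?_, fun m ω => ?_, ?_, ?_, ?_⟩
  · refine Measurable.ite (hbad m) ?_ ?_ <;> exact measurable_const
  · by_cases h : ω ∈ bad m
    · simp [κ, h]
    · simp only [κ, h, if_false]
      exact ⟨inv_nonneg.2 (by linarith [hpos m]), inv_le_one_of_one_le₀ (hpos m)⟩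
  · exact (integrable_const _).add (integrable_toReal_of_lintegral_ne_top hwm.aemeasurable hwint)
  · filter_upwards [ae_lt_top hwm hwint] with ω hω m
    have h0 : 0 ≤ D / a := by positivity
    by_cases h : ω ∈ bad m
    · have h1 : (m : ENNReal) ≤ w ω := by
        refine le_trans (le_of_eq ?_) (ENNReal.le_tsum m)
        rw [Set.indicator_of_mem h]
      have h2 := (ENNReal.toReal_le_toReal (by simp) hω.ne).2 h1
      simp only [ENNReal.toReal_natCast] at h2
      simp only [κ, h, if_true, mul_one]
      linarith
    · simp only [κ, h, if_false]
      refine le_trans ?_ (le_add_of_nonneg_right ENNReal.toReal_nonneg)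
      rw [← div_eq_mul_inv, div_le_div_iff₀ (by linarith [hpos m]) ha]
      have : D * (1 + a / D * m) = D + a * m := by field_simp
      rw [this]
      linarith
  · intro m ω u
    have hsum0 : 0 ≤ ∑ i ∈ Finset.range m, (X (i + 1) ω ⬝ᵥ u) ^ 2 / D :=
      Finset.sum_nonneg fun i _ => by positivity
    by_cases h : ω ∈ bad m
    · simp only [κ, h, if_true, one_mul]
      linarith
    · simp only [κ, h, if_false]
      rw [← div_eq_inv_mul, le_div_iff₀ (by linarith [hpos m])]
      suffices h : a * m * (u ⬝ᵥ u) ≤ ∑ i ∈ Finset.range m, (X (i + 1) ω ⬝ᵥ u) ^ 2 by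
        rw [← Finset.sum_div, mul_add, mul_one]
        gcongr
        rw [le_div_iff₀ hD]
        refine le_trans (le_of_eq ?_) h
        field_simp
      rcases (dotProduct_self_nonneg' u).eq_or_lt with h0 | h0
      · rw [← h0, mul_zero]
        exact Finset.sum_nonneg fun i _ => sq_nonneg _
      · set s := Real.sqrt (u ⬝ᵥ u) with hs
        have hs0 : 0 < s := Real.sqrt_pos.2 h0
        have hss : s ^ 2 = u ⬝ᵥ u := Real.sq_sqrt h0.le
        have hunit : (s⁻¹ • u) ⬝ᵥ (s⁻¹ • u) = 1 := by
          rw [smul_dotProduct, dotProduct_smul, smul_eq_mul, smul_eq_mul, ← hss]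
          field_simp
        have h1 := hgrow m ω h _ hunit
        have h2 : ∀ i, (X (i + 1) ω ⬝ᵥ (s⁻¹ • u)) ^ 2 =
            (X (i + 1) ω ⬝ᵥ u) ^ 2 / (u ⬝ᵥ u) := fun i => by
          rw [dotProduct_smul, smul_eq_mul, mul_pow, ← hss]; field_simp
        simp only [h2] at h1
        rwa [← Finset.sum_div, le_div_iff₀ h0] at h1

end Coercivity

/-! ### Conditional second moments of the estimation error -/

namespace IsRegressionFlow

variable {Ω : Type*} [mΩ : MeasurableSpace Ω] {μ : Measure Ω}
  [IsProbabilityMeasure μ] {n : ℕ}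
  {X : ℕ → Ω → (Fin n → ℝ)} {ε : ℕ → Ω → ℝ} {σ : ℝ}
  {F O : Filtration ℕ mΩ} {K : ℕ → MeasurableSpace Ω}

theorem measurable_dot_X (h : IsRegressionFlow μ X ε σ F O K) {i N : ℕ} (hi : i < N) :
    Measurable[F N] fun ω => X (i + 1) ω ⬝ᵥ X (i + 1) ω :=
  measurable_dot.comp (h.measurable_X_of_lt hi)

theorem measurable_dotProduct {m : MeasurableSpace Ω} {u v : Ω → Fin n → ℝ}
    (hu : Measurable u) (hv : Measurable v) : Measurable fun ω => u ω ⬝ᵥ v ω := by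
  unfold dotProduct
  exact Finset.measurable_sum _ fun i _ =>
    ((measurable_pi_apply i).comp hu).mul ((measurable_pi_apply i).comp hv)

/-- A weight of the past times the squared norm of the next covariate. -/
theorem integrable_X_sq_mul (h : IsRegressionFlow μ X ε σ F O K) (i : ℕ) {Z : Ω → ℝ}
    (hZ : Integrable Z μ) (hZm : Measurable[O i] Z) :
    Integrable (fun ω => (X (i + 1) ω ⬝ᵥ X (i + 1) ω) * Z ω) μ := by
  have hind : IndepFun (fun ω => X (i + 1) ω ⬝ᵥ X (i + 1) ω) Z μ := by
    rw [IndepFun_iff_Indep]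
    refine indep_of_indep_of_le_left (indep_of_indep_of_le_right (h.indep_X i) hZm.comap_le) ?_
    exact (measurable_dot.comp (comap_measurable (X (i + 1)))).comap_le
  exact hind.integrable_mul (h.integrable_X_sq i) hZ

theorem integral_X_sq_mul (h : IsRegressionFlow μ X ε σ F O K) (i : ℕ) {Z : Ω → ℝ}
    (hZm : Measurable[O i] Z) :
    ∫ ω, (X (i + 1) ω ⬝ᵥ X (i + 1) ω) * Z ω ∂μ =
      (∫ ω, X 1 ω ⬝ᵥ X 1 ω ∂μ) * ∫ ω, Z ω ∂μ := by
  have hind : IndepFun (fun ω => X (i + 1) ω ⬝ᵥ X (i + 1) ω) Z μ := by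
    rw [IndepFun_iff_Indep]
    refine indep_of_indep_of_le_left (indep_of_indep_of_le_right (h.indep_X i) hZm.comap_le) ?_
    exact (measurable_dot.comp (comap_measurable (X (i + 1)))).comap_le
  have h0 : ∫ ω, X (i + 1) ω ⬝ᵥ X (i + 1) ω ∂μ = ∫ ω, X 1 ω ⬝ᵥ X 1 ω ∂μ :=
    ((h.ident_X i).comp measurable_dot).integral_eq
  rw [← h0]
  exact hind.integral_fun_mul_eq_mul_integral (h.integrable_X_sq i).aestronglyMeasurable
    (hZm.mono (O.le i) le_rfl).aestronglyMeasurable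

theorem condLE_X_sq_mul (h : IsRegressionFlow μ X ε σ F O K) {i N : ℕ} (hi : i < N)
    {Z B : Ω → ℝ} (hZ : CondLE μ (F N) Z B) (hZm : Measurable[O i] Z) :
    CondLE μ (F N) (fun ω => (X (i + 1) ω ⬝ᵥ X (i + 1) ω) * Z ω)
      (fun ω => (X (i + 1) ω ⬝ᵥ X (i + 1) ω) * B ω) :=
  hZ.mul_left (h.measurable_dot_X hi) (fun _ => dotProduct_self_nonneg' _)
    (h.integrable_X_sq_mul i hZ.1 hZm)

/-- The squared norm of `∑_{i < m} g_{i+1} ε_{i+1} X_{i+1}` for a bounded predictable `g`. -/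
theorem condLE_martingale_sq (h : IsRegressionFlow μ X ε σ F O K) {g : ℕ → Ω → ℝ} {c : ℝ}
    (hg : ∀ i, Measurable[O i] (g (i + 1))) (hc : ∀ i ω, |g (i + 1) ω| ≤ c) (N : ℕ) (m : ℕ)
    (hm : m ≤ N) :
    CondLE μ (F N)
      (fun ω => (∑ i ∈ Finset.range m, (ε (i + 1) ω * g (i + 1) ω) • X (i + 1) ω) ⬝ᵥ
        (∑ i ∈ Finset.range m, (ε (i + 1) ω * g (i + 1) ω) • X (i + 1) ω))
      (fun ω => c ^ 2 * σ ^ 2 * ∑ i ∈ Finset.range m, X (i + 1) ω ⬝ᵥ X (i + 1) ω) := by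
  induction m with
  | zero => simpa using CondLE.const (μ := μ) (F.le N) 0
  | succ m ih =>
    have ih := ih (by omega)
    set T : Ω → Fin n → ℝ := fun ω =>
      ∑ i ∈ Finset.range m, (ε (i + 1) ω * g (i + 1) ω) • X (i + 1) ω with hT
    have hTm : Measurable[O m] T := by
      refine Finset.measurable_sum _ fun i hi => ?_
      have hi' := Finset.mem_range.1 hi
      exact Measurable.smul ((h.measurable_ε_of_lt hi').mul ((hg i).mono (O.mono hi'.le) le_rfl))
        ((h.measurable_X_of_lt hi').mono (h.F_le_O m) le_rfl)
    have hc0 : 0 ≤ c := by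
      obtain ⟨ω⟩ : Nonempty Ω := nonempty_of_isProbabilityMeasure μ
      exact (abs_nonneg _).trans (hc 0 ω)
    set a : Ω → ℝ := fun ω => 2 * (T ω ⬝ᵥ X (m + 1) ω) * g (m + 1) ω with ha
    have hXK : Measurable[K m] (X (m + 1)) :=
      (h.meas_X m).mono (h.F_le_K _ _) le_rfl
    have hgK : Measurable[K m] (g (m + 1)) := (hg m).mono (h.O_le_K m) le_rfl
    have haK : Measurable[K m] a := by
      have hTK : Measurable[K m] T := hTm.mono (h.O_le_K m) le_rfl
      exact ((measurable_dotProduct hTK hXK).const_mul 2).mul hgK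
    have hai : Integrable a μ := by
      refine Integrable.mono' ((ih.1.add (h.integrable_X_sq m)).const_mul c)
        (haK.mono (h.K_le m) le_rfl).aestronglyMeasurable (ae_of_all _ fun ω => ?_)
      rw [Real.norm_eq_abs, ha, abs_mul, mul_comm]
      refine mul_le_mul (hc m ω) ?_ (abs_nonneg _) hc0
      simp only [Pi.add_apply, dotProduct, Finset.mul_sum, ← Finset.sum_add_distrib]
      refine (Finset.abs_sum_le_sum_abs _ _).trans (Finset.sum_le_sum fun l _ => ?_)
      rw [abs_le]
      constructor <;> nlinarith [sq_nonneg (T ω l - X (m + 1) ω l), sq_nonneg (T ω l + X (m + 1) ω l)]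
    have h1 := h.condLE_mul_ε m N hai haK
    have h2 := h.condLE_mul_ε_sq m N
      (CondLE.self (μ := μ) (F.le N) (h.measurable_dot_X (i := m) (by omega))
        (h.integrable_X_sq m)) ((h.measurable_dot_X (i := m) (by omega)).mono (h.F_le_K (m + 1) m) le_rfl)
    have h3 : CondLE μ (F N) (fun ω => (ε (m + 1) ω * g (m + 1) ω) ^ 2 *
        (X (m + 1) ω ⬝ᵥ X (m + 1) ω))
        (fun ω => c ^ 2 * (σ ^ 2 * (X (m + 1) ω ⬝ᵥ X (m + 1) ω))) := by
      refine (h2.const_mul (sq_nonneg c)).mono ?_ ?_ ?_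
      · exact (((h.measurable_ε m).mul (hgK.mono (h.K_le m) le_rfl)).pow_const 2 |>.mul
          (measurable_dot.comp (h.measurable_X m))).aestronglyMeasurable
      · exact ae_of_all _ fun ω => mul_nonneg (sq_nonneg _) (dotProduct_self_nonneg' _)
      · refine ae_of_all _ fun ω => ?_
        have : g (m + 1) ω ^ 2 ≤ c ^ 2 := sq_le_sq' (abs_le.1 (hc m ω)).1 (abs_le.1 (hc m ω)).2
        calc _ = g (m + 1) ω ^ 2 * ((X (m + 1) ω ⬝ᵥ X (m + 1) ω) * ε (m + 1) ω ^ 2) := by ring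
          _ ≤ _ := mul_le_mul_of_nonneg_right this
            (mul_nonneg (dotProduct_self_nonneg' _) (sq_nonneg _))
    convert ((ih.add h1).add h3).congr_right (B' := fun ω => c ^ 2 * σ ^ 2 *
      ∑ i ∈ Finset.range (m + 1), X (i + 1) ω ⬝ᵥ X (i + 1) ω) (ae_of_all _ fun ω => ?_) using 1
    · ext ω
      rw [Finset.sum_range_succ]
      change (T ω + _) ⬝ᵥ (T ω + _) = T ω ⬝ᵥ T ω + _ + _
      rw [add_dotProduct, dotProduct_add, dotProduct_add, dotProduct_smul, smul_dotProduct,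
        smul_dotProduct, dotProduct_smul, dotProduct_comm (X (m + 1) ω) (T ω), ha]
      simp only [smul_eq_mul]
      ring
    · rw [Finset.sum_range_succ]
      refine le_of_eq ?_
      ring

/-- The truncated fourth moment of the noise that controls the feedback of one observation. -/
noncomputable def noiseTail (μ : Measure Ω) (ε : ℕ → Ω → ℝ) (L : ℝ) (i : ℕ) : ℝ :=
  ∫ ω, ε 1 ω ^ 2 * min 1 (L * ε 1 ω ^ 2 / ((i : ℝ) + 1)) ∂μ

theorem tendsto_noiseTail (h : IsRegressionFlow μ X ε σ F O K) {L : ℝ} (hL : 0 ≤ L) :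
    Tendsto (noiseTail μ ε L) atTop (𝓝 0) := by
  have h0 : Tendsto (noiseTail μ ε L) atTop (𝓝 (∫ _, (0 : ℝ) ∂μ)) := by
    refine tendsto_integral_of_dominated_convergence (fun ω => ε 1 ω ^ 2) (fun i => ?_)
      (h.integrable_ε_sq 0) (fun i => ae_of_all _ fun ω => ?_) (ae_of_all _ fun ω => ?_)
    · have := h.measurable_ε 0
      exact Measurable.aestronglyMeasurable (by fun_prop)
    · rw [Real.norm_of_nonneg (mul_nonneg (sq_nonneg _)
        (le_min zero_le_one (by positivity)))]
      exact mul_le_of_le_one_right (sq_nonneg _) (min_le_left _ _)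
    · have h1 : Tendsto (fun i : ℕ => L * ε 1 ω ^ 2 / ((i : ℝ) + 1)) atTop (𝓝 0) :=
        Tendsto.const_div_atTop (tendsto_natCast_atTop_atTop.atTop_add tendsto_const_nhds) _
      have h2 := (tendsto_const_nhds (x := (1 : ℝ))).min h1
      simpa using h2.const_mul (ε 1 ω ^ 2)
  simpa using h0

theorem condLE_noiseTail (h : IsRegressionFlow μ X ε σ F O K) {L : ℝ} (hL : 0 ≤ L) (i N : ℕ) :
    CondLE μ (F N) (fun ω => ε (i + 1) ω ^ 2 * min 1 (L * ε (i + 1) ω ^ 2 / ((i : ℝ) + 1)))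
      (fun _ => noiseTail μ ε L i) := by
  have hφ : Measurable fun x : ℝ => x ^ 2 * min 1 (L * x ^ 2 / ((i : ℝ) + 1)) := by fun_prop
  have h1 : noiseTail μ ε L i =
      ∫ ω, ε (i + 1) ω ^ 2 * min 1 (L * ε (i + 1) ω ^ 2 / ((i : ℝ) + 1)) ∂μ :=
    ((h.ident_ε i).comp hφ).integral_eq.symm
  rw [h1]
  refine CondLE.of_indep (F.le N) (hφ.comp (h.measurable_ε i))
    (indep_of_indep_of_le_right (h.indep_comp_ε i hφ) (h.F_le_K N i)) ?_
  refine (h.integrable_ε_sq i).mono' (hφ.comp (h.measurable_ε i)).aestronglyMeasurable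
    (ae_of_all _ fun ω => ?_)
  rw [Real.norm_of_nonneg (mul_nonneg (sq_nonneg _) (le_min zero_le_one (by positivity)))]
  exact mul_le_of_le_one_right (sq_nonneg _) (min_le_left _ _)

/-- A priori bound on the error. -/
theorem condLE_error (h : IsRegressionFlow μ X ε σ F O K) {e : ℕ → Ω → Fin n → ℝ}
    (he : ∀ m, Measurable[O m] (e m)) {κ : ℕ → Ω → ℝ} (hκ : ∀ m, Measurable[F m] (κ m))
    (hκ01 : ∀ m ω, 0 ≤ κ m ω ∧ κ m ω ≤ 1) {E₀ d : ℝ} (hd : 0 < d)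
    (hb : ∀ᵐ ω ∂μ, ∀ m, e m ω ⬝ᵥ e m ω ≤
      κ m ω * (E₀ + ∑ i ∈ Finset.range m, ε (i + 1) ω ^ 2 / d)) {m N : ℕ} (hm : m ≤ N) :
    CondLE μ (F N) (fun ω => e m ω ⬝ᵥ e m ω) (fun ω => κ m ω * (E₀ + m * (σ ^ 2 / d))) := by
  have hκN : Measurable[F N] (κ m) := (hκ m).mono (F.mono hm) le_rfl
  have hs : CondLE μ (F N) (κ m) (κ m) := by
    refine CondLE.self (F.le N) hκN (Integrable.of_bound
      (hκN.mono (F.le N) le_rfl).aestronglyMeasurable 1 (ae_of_all _ fun ω => ?_))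
    rw [Real.norm_of_nonneg (hκ01 m ω).1]
    exact (hκ01 m ω).2
  have h1 := fun i => (h.condLE_mul_ε_sq i N hs (hκN.mono (h.F_le_K N i) le_rfl)).const_mul
    (inv_nonneg.2 hd.le)
  have h0 : CondLE μ (F N) (fun ω => E₀ * κ m ω) (fun ω => E₀ * κ m ω) := by
    refine CondLE.self (F.le N) (hκN.const_mul _) (hs.1.const_mul _)
  have h2 := h0.add (CondLE.sum (Finset.range m) fun i _ => h1 i)
  refine (h2.mono (measurable_dot.comp ((he m).mono (O.le m) le_rfl)).aestronglyMeasurable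
    (ae_of_all _ fun ω => dotProduct_self_nonneg' _) ?_).congr_right (ae_of_all _ fun ω => ?_)
  · filter_upwards [hb] with ω hω
    refine (hω m).trans (le_of_eq ?_)
    rw [mul_add, Finset.mul_sum, mul_comm]
    congr 1
    refine Finset.sum_congr rfl fun i _ => ?_
    ring
  · refine le_of_eq ?_
    simp only [Finset.sum_const, Finset.card_range, nsmul_eq_mul]
    ring

/-- The conditional bound for the squared feedback term of observation `i + 1`. -/
noncomputable def feedbackBound (μ : Measure Ω) (X : ℕ → Ω → (Fin n → ℝ)) (ε : ℕ → Ω → ℝ) (σ : ℝ)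
    (κ : ℕ → Ω → ℝ) (E₀ d C L : ℝ) (v i : ℕ) (ω : Ω) : ℝ :=
  C * ((if i < v then σ ^ 2 else noiseTail μ ε L i) +
    L / ((i : ℝ) + 1) * (σ ^ 2 *
      ((X (i + 1) ω ⬝ᵥ X (i + 1) ω) * (κ i ω * (E₀ + i * (σ ^ 2 / d))))))

/-- The conditional bound for the squared estimation error after `m` observations. -/
noncomputable def errorBound (μ : Measure Ω) (X : ℕ → Ω → (Fin n → ℝ)) (ε : ℕ → Ω → ℝ) (σ : ℝ)
    (κ : ℕ → Ω → ℝ) (E₀ d C L c : ℝ) (v m : ℕ) (ω : Ω) : ℝ :=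
  3 * κ m ω ^ 2 * (E₀ + c ^ 2 * σ ^ 2 * (∑ i ∈ Finset.range m, X (i + 1) ω ⬝ᵥ X (i + 1) ω) +
    ∑ i ∈ Finset.range m, (∑ i ∈ Finset.range m, X (i + 1) ω ⬝ᵥ X (i + 1) ω) *
      feedbackBound μ X ε σ κ E₀ d C L v i ω)

theorem condLE_feedback (h : IsRegressionFlow μ X ε σ F O K) {e : ℕ → Ω → Fin n → ℝ}
    (he : ∀ m, Measurable[O m] (e m)) {κ : ℕ → Ω → ℝ} (hκ : ∀ m, Measurable[F m] (κ m))
    (hκ01 : ∀ m ω, 0 ≤ κ m ω ∧ κ m ω ≤ 1) {E₀ d : ℝ} (hd : 0 < d)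
    (hb : ∀ᵐ ω ∂μ, ∀ m, e m ω ⬝ᵥ e m ω ≤
      κ m ω * (E₀ + ∑ i ∈ Finset.range m, ε (i + 1) ω ^ 2 / d))
    {C L : ℝ} (hC : 0 ≤ C) (hL : 0 ≤ L) {v : ℕ} {q : Ω → ℝ} (hq : Measurable q)
    (hq0 : ∀ ω, 0 ≤ q ω) (hqC : ∀ᵐ ω ∂μ, q ω ≤ C) {i N : ℕ} (hi : i < N)
    (hqL : v ≤ i → ∀ᵐ ω ∂μ, q ω ≤ C * min 1
      (L * (ε (i + 1) ω ^ 2 + (X (i + 1) ω ⬝ᵥ e i ω) ^ 2) / ((i : ℝ) + 1))) :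
    CondLE μ (F N) (fun ω => q ω * ε (i + 1) ω ^ 2) (feedbackBound μ X ε σ κ E₀ d C L v i) := by
  have hXe : CondLE μ (F N)
      (fun ω => (X (i + 1) ω ⬝ᵥ X (i + 1) ω) * (e i ω ⬝ᵥ e i ω) * ε (i + 1) ω ^ 2)
      (fun ω => σ ^ 2 * ((X (i + 1) ω ⬝ᵥ X (i + 1) ω) * (κ i ω * (E₀ + i * (σ ^ 2 / d))))) := by
    refine h.condLE_mul_ε_sq i N (h.condLE_X_sq_mul hi (h.condLE_error he hκ hκ01 hd hb hi.le)
      (measurable_dot.comp (he i))) ?_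
    have h1 : Measurable[K i] fun ω => X (i + 1) ω ⬝ᵥ X (i + 1) ω :=
      (h.measurable_dot_X hi).mono (h.F_le_K N i) le_rfl
    exact h1.mul ((measurable_dot.comp (he i)).mono (h.O_le_K i) le_rfl)
  have hL' : 0 ≤ L / ((i : ℝ) + 1) := by positivity
  have hfirst : CondLE μ (F N) (fun ω => if i < v then ε (i + 1) ω ^ 2 else
      ε (i + 1) ω ^ 2 * min 1 (L * ε (i + 1) ω ^ 2 / ((i : ℝ) + 1)))
      (fun _ => if i < v then σ ^ 2 else noiseTail μ ε L i) := by
    split_ifs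
    · have := h.condLE_mul_ε_sq i N (CondLE.const (μ := μ) (F.le N) 1) measurable_const
      simpa using this
    · exact h.condLE_noiseTail hL i N
  refine ((hfirst.add (hXe.const_mul hL')).const_mul hC).mono
    (hq.mul ((h.measurable_ε i).pow_const 2)).aestronglyMeasurable
    (ae_of_all _ fun ω => mul_nonneg (hq0 ω) (sq_nonneg _)) ?_
  have hXe0 : ∀ ω, 0 ≤ (X (i + 1) ω ⬝ᵥ X (i + 1) ω) * (e i ω ⬝ᵥ e i ω) := fun ω =>
    mul_nonneg (dotProduct_self_nonneg' _) (dotProduct_self_nonneg' _)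
  by_cases hiv : i < v
  · filter_upwards [hqC] with ω hω
    simp only [hiv, if_true]
    have h1 : q ω * ε (i + 1) ω ^ 2 ≤ C * ε (i + 1) ω ^ 2 := by gcongr
    refine h1.trans (mul_le_mul_of_nonneg_left (le_add_of_nonneg_right ?_) hC)
    exact mul_nonneg hL' (mul_nonneg (hXe0 ω) (sq_nonneg _))
  · filter_upwards [hqL (not_lt.1 hiv)] with ω hω
    simp only [hiv, if_false]
    set x := ε (i + 1) ω ^ 2 with hx
    have hx0 : 0 ≤ x := sq_nonneg _
    have h1 := dotProduct_sq_le (X (i + 1) ω) (e i ω)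
    have h2 : min 1 (L * (x + (X (i + 1) ω ⬝ᵥ e i ω) ^ 2) / ((i : ℝ) + 1)) ≤
        min 1 (L * x / ((i : ℝ) + 1)) + L / ((i : ℝ) + 1) *
          ((X (i + 1) ω ⬝ᵥ X (i + 1) ω) * (e i ω ⬝ᵥ e i ω)) := by
      have h3 : L * (x + (X (i + 1) ω ⬝ᵥ e i ω) ^ 2) / ((i : ℝ) + 1) ≤ L * x / ((i : ℝ) + 1) +
          L / ((i : ℝ) + 1) * ((X (i + 1) ω ⬝ᵥ X (i + 1) ω) * (e i ω ⬝ᵥ e i ω)) := by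
        rw [mul_add, add_div, mul_div_right_comm L ((X (i + 1) ω ⬝ᵥ e i ω) ^ 2)]
        gcongr
      rw [← min_add_add_right]
      exact min_le_min (le_add_of_nonneg_right (mul_nonneg hL' (hXe0 ω))) h3
    calc q ω * x ≤ C * (min 1 (L * x / ((i : ℝ) + 1)) + L / ((i : ℝ) + 1) *
          ((X (i + 1) ω ⬝ᵥ X (i + 1) ω) * (e i ω ⬝ᵥ e i ω))) * x := by
          refine mul_le_mul_of_nonneg_right (hω.trans ?_) hx0
          exact mul_le_mul_of_nonneg_left h2 hC
      _ = _ := by ring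

/-- Refined bound on the error on an event `A` where the gains are nearly predictable. -/
theorem condLE_error_refined (h : IsRegressionFlow μ X ε σ F O K) {e : ℕ → Ω → Fin n → ℝ}
    (he : ∀ m, Measurable[O m] (e m)) {κ : ℕ → Ω → ℝ} (hκ : ∀ m, Measurable[F m] (κ m))
    (hκ01 : ∀ m ω, 0 ≤ κ m ω ∧ κ m ω ≤ 1) {e₀ : Fin n → ℝ} {d : ℝ} (hd : 0 < d)
    (hb : ∀ᵐ ω ∂μ, ∀ m, e m ω ⬝ᵥ e m ω ≤
      κ m ω * (e₀ ⬝ᵥ e₀ + ∑ i ∈ Finset.range m, ε (i + 1) ω ^ 2 / d))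
    {G g : ℕ → Ω → ℝ} (hG : ∀ i, Measurable (G (i + 1))) (hg : ∀ i, Measurable[O i] (g (i + 1)))
    (hb' : ∀ᵐ ω ∂μ, ∀ m, e m ω ⬝ᵥ e m ω ≤ κ m ω ^ 2 *
      ((e₀ + ∑ i ∈ Finset.range m, (ε (i + 1) ω * G (i + 1) ω) • X (i + 1) ω) ⬝ᵥ
        (e₀ + ∑ i ∈ Finset.range m, (ε (i + 1) ω * G (i + 1) ω) • X (i + 1) ω)))
    {c C L : ℝ} (hc : ∀ i ω, |g (i + 1) ω| ≤ c) (hC : 0 ≤ C) (hL : 0 ≤ L) {v : ℕ}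
    {A : Set Ω} (hA : MeasurableSet A)
    (hDC : ∀ᵐ ω ∂μ, ω ∈ A → ∀ i, (G (i + 1) ω - g (i + 1) ω) ^ 2 ≤ C)
    (hDL : ∀ᵐ ω ∂μ, ω ∈ A → ∀ i, v ≤ i → (G (i + 1) ω - g (i + 1) ω) ^ 2 ≤ C * min 1
      (L * (ε (i + 1) ω ^ 2 + (X (i + 1) ω ⬝ᵥ e i ω) ^ 2) / ((i : ℝ) + 1)))
    {m N : ℕ} (hm : m ≤ N) :
    CondLE μ (F N) (A.indicator fun ω => e m ω ⬝ᵥ e m ω)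
      (errorBound μ X ε σ κ (e₀ ⬝ᵥ e₀) d C L c v m) := by
  set q : ℕ → Ω → ℝ := fun i => A.indicator fun ω => (G (i + 1) ω - g (i + 1) ω) ^ 2 with hqdef
  have hgm : ∀ i, Measurable (g (i + 1)) := fun i => (hg i).mono (O.le i) le_rfl
  have hq : ∀ i, Measurable (q i) := fun i =>
    (((hG i).sub (hgm i)).pow_const 2).indicator hA
  have hq0 : ∀ i ω, 0 ≤ q i ω := fun i ω => Set.indicator_nonneg (fun _ _ => sq_nonneg _) ω
  have hqC : ∀ i, ∀ᵐ ω ∂μ, q i ω ≤ C := fun i => by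
    filter_upwards [hDC] with ω hω
    by_cases hωA : ω ∈ A
    · simpa [q, hωA] using hω hωA i
    · simpa [q, hωA] using hC
  have hqL : ∀ i, v ≤ i → ∀ᵐ ω ∂μ, q i ω ≤ C * min 1
      (L * (ε (i + 1) ω ^ 2 + (X (i + 1) ω ⬝ᵥ e i ω) ^ 2) / ((i : ℝ) + 1)) := fun i hi => by
    filter_upwards [hDL] with ω hω
    by_cases hωA : ω ∈ A
    · simpa [q, hωA] using hω hωA i hi
    · simp only [q, hωA, Set.indicator_of_notMem, not_false_eq_true]
      exact mul_nonneg hC (le_min zero_le_one (by positivity))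
  set S : Ω → ℝ := fun ω => ∑ i ∈ Finset.range m, X (i + 1) ω ⬝ᵥ X (i + 1) ω with hS
  have hSm : Measurable[F N] S := Finset.measurable_sum _ fun i hi =>
    h.measurable_dot_X ((Finset.mem_range.1 hi).trans_le hm)
  have hS0 : ∀ ω, 0 ≤ S ω := fun ω => Finset.sum_nonneg fun i _ => dotProduct_self_nonneg' _
  have hSi : Integrable S μ := integrable_finsetSum _ fun i _ => h.integrable_X_sq i
  have hT3 : ∀ i ∈ Finset.range m, CondLE μ (F N) (fun ω => S ω * (q i ω * ε (i + 1) ω ^ 2))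
      (fun ω => S ω * feedbackBound μ X ε σ κ (e₀ ⬝ᵥ e₀) d C L v i ω) := fun i hi => by
    have hiN : i < N := (Finset.mem_range.1 hi).trans_le hm
    refine (h.condLE_feedback he hκ hκ01 hd hb hC hL (hq i) (hq0 i) (hqC i) hiN
      (hqL i)).mul_left hSm hS0 ?_
    have h1 := (h.condLE_mul_ε_sq i N (CondLE.self (F.le N) hSm hSi)
      (hSm.mono (h.F_le_K N i) le_rfl)).1.const_mul C
    refine h1.mono' ((hSm.mono (F.le N) le_rfl).mul
      ((hq i).mul ((h.measurable_ε i).pow_const 2))).aestronglyMeasurable ?_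
    filter_upwards [hqC i] with ω hω
    rw [Real.norm_of_nonneg (mul_nonneg (hS0 ω) (mul_nonneg (hq0 i ω) (sq_nonneg _)))]
    calc S ω * (q i ω * ε (i + 1) ω ^ 2) = q i ω * (S ω * ε (i + 1) ω ^ 2) := by ring
      _ ≤ _ := mul_le_mul_of_nonneg_right hω (mul_nonneg (hS0 ω) (sq_nonneg _))
  have hsum := ((CondLE.const (μ := μ) (F.le N) (e₀ ⬝ᵥ e₀)).add
    (h.condLE_martingale_sq hg hc N m hm)).add (CondLE.sum _ hT3)
  have hκN : Measurable[F N] fun ω => 3 * κ m ω ^ 2 :=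
    (((hκ m).mono (F.mono hm) le_rfl).pow_const 2).const_mul 3
  have hκ3 : ∀ ω, 0 ≤ 3 * κ m ω ^ 2 := fun ω => by positivity
  have hfin := hsum.mul_left hκN hκ3 (by
    refine (hsum.1.norm.const_mul 3).mono'
      ((hκN.mono (F.le N) le_rfl).aestronglyMeasurable.mul hsum.1.aestronglyMeasurable)
      (ae_of_all _ fun ω => ?_)
    rw [norm_mul]
    refine mul_le_mul_of_nonneg_right ?_ (norm_nonneg _)
    rw [Real.norm_of_nonneg (hκ3 ω)]
    have := hκ01 m ω
    nlinarith)
  refine hfin.mono ((measurable_dot.comp ((he m).mono (O.le m) le_rfl)).indicator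
    hA).aestronglyMeasurable
    (ae_of_all _ fun ω => Set.indicator_nonneg (fun _ _ => dotProduct_self_nonneg' _) ω) ?_
  filter_upwards [hb'] with ω hω
  by_cases hωA : ω ∈ A
  · rw [Set.indicator_of_mem hωA]
    refine (hω m).trans ?_
    rw [mul_comm 3, mul_assoc]
    refine mul_le_mul_of_nonneg_left ?_ (sq_nonneg _)
    have hsplit : e₀ + ∑ i ∈ Finset.range m, (ε (i + 1) ω * G (i + 1) ω) • X (i + 1) ω =
        e₀ + ∑ i ∈ Finset.range m, (ε (i + 1) ω * g (i + 1) ω) • X (i + 1) ω +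
          ∑ i ∈ Finset.range m, (ε (i + 1) ω * (G (i + 1) ω - g (i + 1) ω)) • X (i + 1) ω := by
      rw [add_assoc, ← Finset.sum_add_distrib]
      congr 1
      refine Finset.sum_congr rfl fun i _ => ?_
      rw [← add_smul]; congr 1; ring
    rw [hsplit]
    refine (dotProduct_add_add_self_le _ _ _).trans ?_
    gcongr
    refine (dotProduct_sum_smul_self_le _ _ _).trans (le_of_eq ?_)
    rw [Finset.mul_sum]
    refine Finset.sum_congr rfl fun i _ => ?_
    simp only [q, Set.indicator_of_mem hωA]
    ring
  · rw [Set.indicator_of_notMem hωA]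
    refine mul_nonneg (hκ3 ω) (add_nonneg (add_nonneg (dotProduct_self_nonneg' _)
      (dotProduct_self_nonneg' _)) (Finset.sum_nonneg fun i _ => ?_))
    exact mul_nonneg (hS0 ω) (mul_nonneg (hq0 i ω) (sq_nonneg _))

theorem noiseTail_nonneg {L : ℝ} (hL : 0 ≤ L) (i : ℕ) : 0 ≤ noiseTail μ ε L i :=
  integral_nonneg fun ω => mul_nonneg (sq_nonneg _) (le_min zero_le_one (by positivity))

/-- The error bound vanishes along every path with linearly growing information. -/
theorem tendsto_errorBound (h : IsRegressionFlow μ X ε σ F O K) {κ : ℕ → Ω → ℝ} {W : ℝ} {ω : Ω}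
    (hκ0 : ∀ m, 0 ≤ κ m ω ∧ κ m ω ≤ 1) (hW : ∀ m : ℕ, m * κ m ω ≤ W) {E₀ d C L c C' : ℝ}
    (hE₀ : 0 ≤ E₀) (hd : 0 < d) (hC : 0 ≤ C) (hL : 0 ≤ L) (v : ℕ)
    (hS : ∀ m : ℕ, ∑ i ∈ Finset.range m, X (i + 1) ω ⬝ᵥ X (i + 1) ω ≤ C' * m) :
    Tendsto (fun m => errorBound μ X ε σ κ E₀ d C L c v m ω) atTop (𝓝 0) := by
  have hW0 : 0 ≤ W := by simpa using hW 0
  have hx : ∀ i, 0 ≤ X (i + 1) ω ⬝ᵥ X (i + 1) ω := fun i => dotProduct_self_nonneg' _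
  have hC' : 0 ≤ C' := by have := hS 1; simp at this; exact (hx 0).trans this
  set b : ℕ → ℝ := fun i => κ i ω * (E₀ + i * (σ ^ 2 / d)) with hb
  have hb0 : ∀ i, 0 ≤ b i := fun i => mul_nonneg (hκ0 i).1 (by positivity)
  have hbB : ∀ i, b i ≤ E₀ + W * (σ ^ 2 / d) := fun i => by
    have h1 : b i = κ i ω * E₀ + (i * κ i ω) * (σ ^ 2 / d) := by rw [hb]; ring
    rw [h1]
    refine add_le_add (mul_le_of_le_one_left hE₀ (hκ0 i).2)
      (mul_le_mul_of_nonneg_right (hW i) (by positivity))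
  set w₁ : ℕ → ℝ := fun i => if i < v then σ ^ 2 else noiseTail μ ε L i with hw₁
  have hw₁t : Tendsto w₁ atTop (𝓝 0) := (h.tendsto_noiseTail hL).congr' (by
    filter_upwards [eventually_ge_atTop v] with i hi
    simp [w₁, not_lt.2 hi])
  set w₂ : ℕ → ℝ := fun i => L / ((i : ℝ) + 1) * (σ ^ 2 * b i) with hw₂
  have hw₂t : Tendsto w₂ atTop (𝓝 0) := by
    have h1 : Tendsto (fun i : ℕ => L / ((i : ℝ) + 1) * (σ ^ 2 * (E₀ + W * (σ ^ 2 / d))))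
        atTop (𝓝 0) := by
      have : Tendsto (fun i : ℕ => L / ((i : ℝ) + 1)) atTop (𝓝 0) :=
        Tendsto.const_div_atTop (tendsto_natCast_atTop_atTop.atTop_add tendsto_const_nhds) _
      simpa using this.mul_const (σ ^ 2 * (E₀ + W * (σ ^ 2 / d)))
    refine squeeze_zero (fun i => mul_nonneg (by positivity) (mul_nonneg (sq_nonneg _) (hb0 i)))
      (fun i => ?_) h1
    exact mul_le_mul_of_nonneg_left (mul_le_mul_of_nonneg_left (hbB i) (sq_nonneg _)) (by positivity)
  set avg : ℕ → ℝ := fun m => (∑ i ∈ Finset.range m, w₁ i) / m +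
    (∑ i ∈ Finset.range m, (X (i + 1) ω ⬝ᵥ X (i + 1) ω) * w₂ i) / m with havg
  have havgt : Tendsto avg atTop (𝓝 0) := by
    simpa using (tendsto_average_zero hw₁t).add (tendsto_weighted_average_zero hx hS hw₂t)
  have hinv : Tendsto (fun m : ℕ => ((m : ℝ))⁻¹) atTop (𝓝 0) :=
    tendsto_inv_atTop_zero.comp tendsto_natCast_atTop_atTop
  have hup : Tendsto (fun m : ℕ => 3 * W ^ 2 * (E₀ * ((m : ℝ)⁻¹ * (m : ℝ)⁻¹) +
      c ^ 2 * σ ^ 2 * C' * (m : ℝ)⁻¹ + C' * C * avg m)) atTop (𝓝 0) := by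
    have h1 := ((hinv.mul hinv).const_mul E₀).add (hinv.const_mul (c ^ 2 * σ ^ 2 * C'))
    have h2 := (h1.add (havgt.const_mul (C' * C))).const_mul (3 * W ^ 2)
    simpa using h2
  have hw₁0 : ∀ i, 0 ≤ w₁ i := fun i => by
    simp only [hw₁]; split_ifs
    · positivity
    · exact noiseTail_nonneg hL i
  have hQ : ∀ i, feedbackBound μ X ε σ κ E₀ d C L v i ω =
      C * (w₁ i + (X (i + 1) ω ⬝ᵥ X (i + 1) ω) * w₂ i) := fun i => by
    rw [feedbackBound, hw₁, hw₂, hb]; ring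
  have hw₂0 : ∀ i, 0 ≤ w₂ i := fun i =>
    mul_nonneg (by positivity) (mul_nonneg (sq_nonneg _) (hb0 i))
  have hS0 : ∀ m, 0 ≤ ∑ i ∈ Finset.range m, X (i + 1) ω ⬝ᵥ X (i + 1) ω := fun m =>
    Finset.sum_nonneg fun i _ => hx i
  refine tendsto_of_tendsto_of_tendsto_of_le_of_le' tendsto_const_nhds hup
    (Eventually.of_forall fun m => ?_) ?_
  · refine mul_nonneg (by positivity) (add_nonneg (add_nonneg hE₀ ?_)
      (Finset.sum_nonneg fun i _ => mul_nonneg (hS0 m) ?_))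
    · exact mul_nonneg (by positivity) (hS0 m)
    · rw [hQ]
      exact mul_nonneg hC (add_nonneg (hw₁0 i) (mul_nonneg (hx i) (hw₂0 i)))
  · filter_upwards [eventually_gt_atTop 0] with m hm
    have hm' : (0 : ℝ) < m := by exact_mod_cast hm
    have hκW : κ m ω ≤ W * (m : ℝ)⁻¹ := by
      rw [← div_eq_mul_inv, le_div_iff₀ hm', mul_comm]; exact hW m
    have hκ2 : κ m ω ^ 2 ≤ (W * (m : ℝ)⁻¹) ^ 2 := pow_le_pow_left₀ (hκ0 m).1 hκW 2
    have hsumQ : ∑ i ∈ Finset.range m, feedbackBound μ X ε σ κ E₀ d C L v i ω =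
        C * (m * avg m) := by
      simp only [hQ, ← Finset.mul_sum, Finset.sum_add_distrib, havg]
      field_simp
    have havg0 : 0 ≤ avg m := add_nonneg
      (div_nonneg (Finset.sum_nonneg fun i _ => hw₁0 i) hm'.le)
      (div_nonneg (Finset.sum_nonneg fun i _ => mul_nonneg (hx i) (hw₂0 i)) hm'.le)
    have hSm := hS m
    rw [errorBound, ← Finset.mul_sum, hsumQ]
    calc _ ≤ 3 * (W * (m : ℝ)⁻¹) ^ 2 * (E₀ + c ^ 2 * σ ^ 2 * (C' * m) +
          (C' * m) * (C * (m * avg m))) := by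
          have := hS0 m
          gcongr
      _ = _ := by field_simp

end IsRegressionFlow

/-! ### Convergence of the conditional noise estimator from a deterministic time -/

theorem abs_mul_sq_sub_sq_le {φ ε a s : ℝ} (h0 : 0 ≤ φ) (h1 : φ ≤ 1) (hs : 0 < s) :
    |φ * (ε - a) ^ 2 - ε ^ 2| ≤ |φ - 1| * ε ^ 2 + s * ε ^ 2 + (1 + s⁻¹) * a ^ 2 := by
  have h2 : |(ε - a) ^ 2 - ε ^ 2| ≤ s * ε ^ 2 + (1 + s⁻¹) * a ^ 2 := by
    have h3 : 0 ≤ s⁻¹ * (s * ε - a) ^ 2 := by positivity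
    have h4 : 0 ≤ s⁻¹ * (s * ε + a) ^ 2 := by positivity
    have h5 : s⁻¹ * (s * ε - a) ^ 2 = s * ε ^ 2 - 2 * ε * a + s⁻¹ * a ^ 2 := by field_simp; ring
    have h6 : s⁻¹ * (s * ε + a) ^ 2 = s * ε ^ 2 + 2 * ε * a + s⁻¹ * a ^ 2 := by field_simp; ring
    rw [abs_le]
    constructor <;> nlinarith [sq_nonneg a]
  have h7 : φ * (ε - a) ^ 2 - ε ^ 2 = φ * ((ε - a) ^ 2 - ε ^ 2) + (φ - 1) * ε ^ 2 := by ring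
  rw [h7]
  refine (abs_add_le _ _).trans ?_
  rw [abs_mul, abs_mul, abs_of_nonneg h0, abs_of_nonneg (sq_nonneg ε)]
  have h8 : φ * |(ε - a) ^ 2 - ε ^ 2| ≤ |(ε - a) ^ 2 - ε ^ 2| :=
    mul_le_of_le_one_left (abs_nonneg _) h1
  linarith

theorem tendsto_zero_of_forall_le_add {c : ℕ → ℝ} (B : ℝ) (hc : ∀ k, 0 ≤ c k)
    (h : ∀ p : ℕ, ∃ u : ℕ → ℝ, Tendsto u atTop (𝓝 0) ∧
      ∀ᶠ k in atTop, c k ≤ u k + B / ((p : ℝ) + 1)) :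
    Tendsto c atTop (𝓝 0) := by
  rw [Metric.tendsto_atTop]
  intro η hη
  have hp : Tendsto (fun p : ℕ => B / ((p : ℝ) + 1)) atTop (𝓝 0) :=
    Tendsto.const_div_atTop (tendsto_natCast_atTop_atTop.atTop_add tendsto_const_nhds) _
  obtain ⟨p, hp⟩ := (hp.eventually_lt_const (half_pos hη)).exists
  obtain ⟨u, hu, hle⟩ := h p
  obtain ⟨N, hN⟩ := eventually_atTop.1 (hle.and (hu.eventually_lt_const (half_pos hη)))
  refine ⟨N, fun k hk => ?_⟩
  obtain ⟨h1, h2⟩ := hN k hk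
  rw [Real.dist_eq, sub_zero, abs_of_nonneg (hc k)]
  linarith

namespace IsRegressionFlow

variable {Ω : Type*} [mΩ : MeasurableSpace Ω] {μ : Measure Ω}
  [IsProbabilityMeasure μ] {n : ℕ}
  {X : ℕ → Ω → (Fin n → ℝ)} {ε : ℕ → Ω → ℝ} {σ : ℝ}
  {F O : Filtration ℕ mΩ} {K : ℕ → MeasurableSpace Ω}

/-- The deviation of the empirical second moment of the noise. -/
noncomputable def noiseDev (ε : ℕ → Ω → ℝ) (σ : ℝ) (v k : ℕ) (ω : Ω) : ℝ :=
  |(∑ j ∈ Finset.range k, ε (v + j + 1) ω ^ 2) / k - σ ^ 2|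

theorem tendsto_integral_noiseDev (h : IsRegressionFlow μ X ε σ F O K) (v : ℕ) :
    Tendsto (fun k => ∫ ω, noiseDev ε σ v k ω ∂μ) atTop (𝓝 0) := by
  have hind : iIndepFun (fun i ω => ε (i + 1) ω ^ 2) μ :=
    h.iIndep_ε.comp (fun _ x => x ^ 2) fun _ => by fun_prop
  have hid : ∀ i j, IdentDistrib (fun ω => ε (i + 1) ω ^ 2) (fun ω => ε (j + 1) ω ^ 2) μ μ :=
    fun i j => ((h.ident_ε i).trans (h.ident_ε j).symm).comp (u := fun x => x ^ 2) (by fun_prop)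
  have hL := strong_law_Lp (μ := μ) (p := 1) le_rfl (by simp) (fun j ω => ε (v + j + 1) ω ^ 2)
    (memLp_one_iff_integrable.2 (h.integrable_ε_sq (v + 0)))
    (fun i j hij => hind.indepFun (by omega : v + i ≠ v + j)) (fun i => hid _ _)
  have hL' := (ENNReal.continuousAt_toReal ENNReal.zero_ne_top).tendsto.comp hL
  refine (hL'.congr fun k => ?_)
  have hmean : ∫ ω, ε (v + 0 + 1) ω ^ 2 ∂μ = σ ^ 2 := h.integral_ε_sq v
  rw [Function.comp_apply, eLpNorm_one_eq_lintegral_enorm, hmean, ← integral_norm_eq_lintegral_enorm]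
  · simp only [noiseDev, Real.norm_eq_abs, smul_eq_mul, div_eq_inv_mul]
  · have := fun j => h.measurable_ε (v + j)
    exact Measurable.aestronglyMeasurable (by fun_prop)

theorem condLE_noiseDev (h : IsRegressionFlow μ X ε σ F O K) (v k N : ℕ) :
    CondLE μ (F N) (noiseDev ε σ v k) (fun _ => ∫ ω, noiseDev ε σ v k ω ∂μ) := by
  have hm : Measurable[seqSigma ε] (noiseDev ε σ v k) := by
    have := fun j => measurable_seqSigma ε (v + j)
    have h1 : Measurable[seqSigma ε] fun ω => ∑ j ∈ Finset.range k, ε (v + j + 1) ω ^ 2 :=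
      Finset.measurable_sum _ fun j _ => (this j).pow_const 2
    exact continuous_abs.measurable.comp ((h1.div_const _).sub_const _)
  have hm' : Measurable (noiseDev ε σ v k) := by
    have := fun j => h.measurable_ε (v + j)
    unfold noiseDev
    exact (((Finset.measurable_sum _ fun j _ => (this j).pow_const 2).div_const _).sub_const _).abs
  refine CondLE.of_indep (F.le N) hm' (indep_of_indep_of_le_left (h.indep_ε_F N) hm.comap_le) ?_
  exact (((integrable_finsetSum _ fun j _ => h.integrable_ε_sq (v + j)).div_const _).sub
    (integrable_const _)).abs

theorem ae_exists_sum_X_sq_le (h : IsRegressionFlow μ X ε σ F O K) :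
    ∀ᵐ ω ∂μ, ∃ C, 0 ≤ C ∧
      ∀ m : ℕ, ∑ i ∈ Finset.range m, X (i + 1) ω ⬝ᵥ X (i + 1) ω ≤ C * m := by
  have hind : iIndepFun (fun i ω => X (i + 1) ω ⬝ᵥ X (i + 1) ω) μ :=
    h.iIndep_X.comp (fun _ x => x ⬝ᵥ x) fun _ => measurable_dot
  have hL := strong_law_ae_real (fun i ω => X (i + 1) ω ⬝ᵥ X (i + 1) ω) (h.integrable_X_sq 0)
    (fun i j hij => hind.indepFun hij)
    (fun i => ((h.ident_X i).trans (h.ident_X 0).symm).comp measurable_dot)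
  filter_upwards [hL] with ω hω
  exact exists_sum_le_mul_of_tendsto hω

/-- Average of weighted squared residuals, started at time `v`. -/
noncomputable def residualAverage (X : ℕ → Ω → (Fin n → ℝ)) (ε : ℕ → Ω → ℝ) (e : ℕ → Ω → Fin n → ℝ)
    (φ : ℕ → Ω → ℝ) (v k : ℕ) (ω : Ω) : ℝ :=
  (∑ j ∈ Finset.range k,
    φ (j + 1) ω * (ε (v + j + 1) ω - X (v + j + 1) ω ⬝ᵥ e (v + j) ω) ^ 2) / k

theorem tendsto_condExp_residualAverage (h : IsRegressionFlow μ X ε σ F O K)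
    {e : ℕ → Ω → Fin n → ℝ} (he : ∀ m, Measurable[O m] (e m)) {v : ℕ} {A : Set Ω}
    (hA : MeasurableSet[F v] A) {EB : ℕ → Ω → ℝ}
    (hEB : ∀ m N, m ≤ N → CondLE μ (F N) (A.indicator fun ω => e m ω ⬝ᵥ e m ω) (EB m))
    (hEBlim : ∀ᵐ ω ∂μ, Tendsto (fun m => EB m ω) atTop (𝓝 0)) {φ : ℕ → Ω → ℝ}
    (hφm : ∀ j, Measurable[F (v + j + 1)] (A.indicator (φ (j + 1))))
    (hφ01 : ∀ᵐ ω ∂μ, ∀ j, 0 ≤ φ (j + 1) ω ∧ φ (j + 1) ω ≤ 1)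
    (hφlim : ∀ᵐ ω ∂μ, Tendsto (fun j => φ j ω) atTop (𝓝 1)) :
    ∀ᵐ ω ∂μ, Tendsto (fun k => (μ[A.indicator fun ω => |residualAverage X ε e φ v k ω - σ ^ 2| |
      F (v + k)]) ω) atTop (𝓝 0) := by
  have hA' : MeasurableSet A := F.le v _ hA
  set ψ : ℕ → Ω → ℝ := fun j => A.indicator fun ω => |φ (j + 1) ω - 1| with hψ
  have hψm : ∀ j, Measurable[F (v + j + 1)] (ψ j) := fun j => by
    have h1 : ψ j = A.indicator fun ω => |A.indicator (φ (j + 1)) ω - 1| := by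
      ext ω
      by_cases hω : ω ∈ A <;> simp [ψ, hω]
    rw [h1]
    exact (continuous_abs.measurable.comp ((hφm j).sub_const 1)).indicator
      (F.mono (by omega) _ hA)
  have hψb : ∀ᵐ ω ∂μ, ∀ j, ψ j ω ≤ 1 := by
    filter_upwards [hφ01] with ω hω j
    obtain ⟨h0, h1⟩ := hω j
    by_cases hωA : ω ∈ A
    · simp only [ψ, hωA, Set.indicator_of_mem]
      rw [abs_le]; constructor <;> linarith
    · simp [ψ, hωA]
  have hψ0 : ∀ j ω, 0 ≤ ψ j ω := fun j ω => Set.indicator_nonneg (fun _ _ => abs_nonneg _) ω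
  have hψi : ∀ j, Integrable (ψ j) μ := fun j => by
    refine Integrable.of_bound ((hψm j).mono (F.le _) le_rfl).aestronglyMeasurable 1 ?_
    filter_upwards [hψb] with ω hω
    rw [Real.norm_of_nonneg (hψ0 j ω)]
    exact hω j
  have hZm : ∀ m, v ≤ m → Measurable[O m] (A.indicator fun ω => e m ω ⬝ᵥ e m ω) := fun m hm =>
    (measurable_dot.comp (he m)).indicator (h.F_le_O m _ (F.mono hm _ hA))
  have key : ∀ (p k : ℕ), CondLE μ (F (v + k))
      (A.indicator fun ω => |residualAverage X ε e φ v k ω - σ ^ 2|)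
      (fun ω => (∫ ω, noiseDev ε σ v k ω ∂μ) + (k : ℝ)⁻¹ * ∑ j ∈ Finset.range k,
        (σ ^ 2 * ψ j ω + 1 / ((p : ℝ) + 1) * σ ^ 2 + (1 + (1 / ((p : ℝ) + 1))⁻¹) *
          ((X (v + j + 1) ω ⬝ᵥ X (v + j + 1) ω) * EB (v + j) ω))) := by
    intro p k
    set s : ℝ := 1 / ((p : ℝ) + 1) with hs
    have hs0 : 0 < s := by positivity
    have hterm : ∀ j ∈ Finset.range k, CondLE μ (F (v + k))
        (fun ω => ψ j ω * ε (v + j + 1) ω ^ 2 + s * ε (v + j + 1) ω ^ 2 + (1 + s⁻¹) *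
          ((X (v + j + 1) ω ⬝ᵥ X (v + j + 1) ω) * A.indicator
            (fun ω => e (v + j) ω ⬝ᵥ e (v + j) ω) ω))
        (fun ω => σ ^ 2 * ψ j ω + s * σ ^ 2 + (1 + s⁻¹) *
          ((X (v + j + 1) ω ⬝ᵥ X (v + j + 1) ω) * EB (v + j) ω)) := fun j hj => by
      have hj' := Finset.mem_range.1 hj
      have hψN : Measurable[F (v + k)] (ψ j) := (hψm j).mono (F.mono (by omega)) le_rfl
      have h1 := h.condLE_mul_ε_sq (v + j) (v + k) (CondLE.self (F.le _) hψN (hψi j))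
        (hψN.mono (h.F_le_K _ _) le_rfl)
      have h2 := h.condLE_mul_ε_sq (v + j) (v + k) (CondLE.const (μ := μ) (F.le _) s)
        measurable_const
      have h3 := (h.condLE_X_sq_mul (i := v + j) (N := v + k) (by omega)
        (hEB (v + j) (v + k) (by omega)) (hZm _ (by omega))).const_mul
          (c := 1 + s⁻¹) (by positivity)
      refine ((h1.add h2).add h3).congr_right (ae_of_all _ fun ω => le_of_eq ?_)
      ring
    have hall := (h.condLE_noiseDev v k (v + k)).add ((CondLE.sum _ hterm).const_mul
      (c := (k : ℝ)⁻¹) (by positivity))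
    refine hall.mono ?_ (ae_of_all _ fun ω => Set.indicator_nonneg (fun _ _ => abs_nonneg _) ω) ?_
    · have h1 : (A.indicator fun ω => |residualAverage X ε e φ v k ω - σ ^ 2|) = A.indicator
          fun ω => |residualAverage X ε e (fun j => A.indicator (φ j)) v k ω - σ ^ 2| := by
        ext ω
        by_cases hω : ω ∈ A <;> simp [residualAverage, hω]
      rw [h1]
      have h2 : ∀ j, Measurable fun ω => X (v + j + 1) ω ⬝ᵥ e (v + j) ω := fun j =>
        measurable_dotProduct (h.measurable_X (v + j)) ((he (v + j)).mono (O.le _) le_rfl)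
      unfold residualAverage
      exact ((((Finset.measurable_sum _ fun j _ => ((hφm j).mono (F.le _) le_rfl).mul
        (((h.measurable_ε (v + j)).sub (h2 j)).pow_const 2)).div_const _).sub_const
          _).abs.indicator hA').aestronglyMeasurable
    · filter_upwards [hφ01] with ω hω
      have hnn : ∀ j ∈ Finset.range k, 0 ≤ ψ j ω * ε (v + j + 1) ω ^ 2 + s * ε (v + j + 1) ω ^ 2 +
          (1 + s⁻¹) * ((X (v + j + 1) ω ⬝ᵥ X (v + j + 1) ω) * A.indicator
            (fun ω => e (v + j) ω ⬝ᵥ e (v + j) ω) ω) := fun j _ => by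
        have h1 := hψ0 j ω
        have h2 := dotProduct_self_nonneg' (X (v + j + 1) ω)
        have h3 : 0 ≤ A.indicator (fun ω => e (v + j) ω ⬝ᵥ e (v + j) ω) ω :=
          Set.indicator_nonneg (fun _ _ => dotProduct_self_nonneg' _) ω
        positivity
      by_cases hωA : ω ∈ A
      · simp only [hωA, Set.indicator_of_mem, ψ]
        have h1 : residualAverage X ε e φ v k ω - σ ^ 2 =
            ((∑ j ∈ Finset.range k, ε (v + j + 1) ω ^ 2) / k - σ ^ 2) +
            (k : ℝ)⁻¹ * ∑ j ∈ Finset.range k, (φ (j + 1) ω *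
              (ε (v + j + 1) ω - X (v + j + 1) ω ⬝ᵥ e (v + j) ω) ^ 2 - ε (v + j + 1) ω ^ 2) := by
          rw [residualAverage, Finset.sum_sub_distrib]; ring
        rw [h1]
        refine (abs_add_le _ _).trans (add_le_add le_rfl ?_)
        rw [abs_mul, abs_of_nonneg (by positivity : (0 : ℝ) ≤ (k : ℝ)⁻¹)]
        refine mul_le_mul_of_nonneg_left ((Finset.abs_sum_le_sum_abs _ _).trans
          (Finset.sum_le_sum fun j _ => ?_)) (by positivity)
        refine (abs_mul_sq_sub_sq_le (hω j).1 (hω j).2 hs0).trans (add_le_add le_rfl ?_)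
        exact mul_le_mul_of_nonneg_left (dotProduct_sq_le _ _) (by positivity)
      · rw [Set.indicator_of_notMem hωA]
        exact add_nonneg (abs_nonneg _) (mul_nonneg (by positivity) (Finset.sum_nonneg hnn))
  have key' : ∀ᵐ ω ∂μ, ∀ p k : ℕ, _ := ae_all_iff.2 fun p => ae_all_iff.2 fun k => (key p k).2
  have hnn : ∀ᵐ ω ∂μ, ∀ k, 0 ≤ (μ[A.indicator fun ω => |residualAverage X ε e φ v k ω - σ ^ 2| |
      F (v + k)]) ω := ae_all_iff.2 fun k => condExp_nonneg
        (ae_of_all _ fun ω => Set.indicator_nonneg (fun _ _ => abs_nonneg _) ω)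
  filter_upwards [key', hnn, hEBlim, hφlim, h.ae_exists_sum_X_sq_le] with ω hkey hnn hEB hφ hS
  obtain ⟨C, hC0, hC⟩ := hS
  refine tendsto_zero_of_forall_le_add (σ ^ 2) hnn fun p => ?_
  set s : ℝ := 1 / ((p : ℝ) + 1) with hs
  have hψlim : Tendsto (fun j => ψ j ω) atTop (𝓝 0) := by
    by_cases hωA : ω ∈ A
    · simp only [ψ, hωA, Set.indicator_of_mem]
      have := (((tendsto_add_atTop_iff_nat 1).2 hφ).sub_const 1).abs
      simpa using this
    · simp [ψ, hωA]
  have hEBlim : Tendsto (fun j => EB (v + j) ω) atTop (𝓝 0) := by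
    simpa only [add_comm v] using (tendsto_add_atTop_iff_nat v).2 hEB
  have hSv : ∀ m : ℕ, ∑ j ∈ Finset.range m, X (v + j + 1) ω ⬝ᵥ X (v + j + 1) ω ≤
      (C * (v + 1)) * m := fun m => by
    rcases Nat.eq_zero_or_pos m with rfl | hm
    · simp
    · have h1 : ∑ j ∈ Finset.range m, X (v + j + 1) ω ⬝ᵥ X (v + j + 1) ω ≤
          ∑ i ∈ Finset.range (v + m), X (i + 1) ω ⬝ᵥ X (i + 1) ω := by
        rw [Finset.sum_range_add]
        exact le_add_of_nonneg_left (Finset.sum_nonneg fun i _ => dotProduct_self_nonneg' _)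
      refine h1.trans ((hC _).trans ?_)
      rw [mul_assoc]
      refine mul_le_mul_of_nonneg_left ?_ hC0
      push_cast
      have : (1 : ℝ) ≤ m := by exact_mod_cast hm
      nlinarith [(Nat.cast_nonneg v : (0 : ℝ) ≤ v)]
  refine ⟨fun k => (∫ ω, noiseDev ε σ v k ω ∂μ) + (σ ^ 2 * ((∑ j ∈ Finset.range k, ψ j ω) / k) +
    (1 + s⁻¹) * ((∑ j ∈ Finset.range k,
      (X (v + j + 1) ω ⬝ᵥ X (v + j + 1) ω) * EB (v + j) ω) / k)), ?_, ?_⟩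
  · have h1 := (tendsto_average_zero hψlim).const_mul (σ ^ 2)
    have h2 := (tendsto_weighted_average_zero (fun j => dotProduct_self_nonneg' _) hSv
      hEBlim).const_mul (1 + s⁻¹)
    simpa using (h.tendsto_integral_noiseDev v).add (h1.add h2)
  · filter_upwards [eventually_gt_atTop 0] with k hk
    have hk' : (0 : ℝ) < k := by exact_mod_cast hk
    refine (hkey p k).trans (le_of_eq ?_)
    simp only [Finset.sum_add_distrib, ← Finset.mul_sum, Finset.sum_const, Finset.card_range,
      nsmul_eq_mul, ← hs]
    have : σ ^ 2 / ((p : ℝ) + 1) = s * σ ^ 2 := by rw [hs]; ring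
    rw [this]
    field_simp
    ring

end IsRegressionFlow

/-! ### Stopped σ-algebras -/

section Stopping

variable {Ω : Type*} [mΩ : MeasurableSpace Ω] {μ : Measure Ω} [IsProbabilityMeasure μ]
  {F : Filtration ℕ mΩ} {V : Ω → WithTop ℕ}

theorem measurable_indicator_of_stopped {τ : Ω → WithTop ℕ} (hτ : IsStoppingTime F τ)
    {f : Ω → ℝ} (hf : Measurable[hτ.measurableSpace] f) (i : ℕ) :
    Measurable[F i] ({ω | τ ω = i}.indicator f) := by
  intro s hs
  rw [Set.indicator_preimage]
  have h1 : MeasurableSet[F i] {ω | τ ω = i} := hτ.measurableSet_eq i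
  have h2 : MeasurableSet[F i] (f ⁻¹' s ∩ {ω | τ ω = i}) :=
    (hτ.measurableSet_inter_eq_iff _ i).1
      (@MeasurableSet.inter _ hτ.measurableSpace _ _ (hf hs) (hτ.measurableSet_eq' i))
  have h3 : MeasurableSet[F i] ((0 : Ω → ℝ) ⁻¹' s) := @measurable_const _ _ _ (F i) 0 _ hs
  exact @MeasurableSet.union _ (F i) _ _ h2 (@MeasurableSet.diff _ (F i) _ _ h3 h1)

theorem tendsto_condExp_stopped (hV : IsStoppingTime F V) (hVfin : ∀ᵐ ω ∂μ, V ω ≠ ⊤)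
    {Z : ℕ → Ω → ℝ} (hZ : ∀ k, 1 ≤ k → Integrable (Z k) μ)
    (h : ∀ v : ℕ, ∀ᵐ ω ∂μ, Tendsto
      (fun k => (μ[{ω | V ω = v}.indicator (Z k) | F (v + k)]) ω) atTop (𝓝 0)) :
    ∀ᵐ ω ∂μ, Tendsto (fun k => (μ[Z k | (hV.add_const' k).measurableSpace]) ω) atTop (𝓝 0) := by
  have h1 : ∀ᵐ ω ∂μ, ∀ v k : ℕ, 1 ≤ k → V ω = v →
      (μ[Z k | (hV.add_const' k).measurableSpace]) ω =
        (μ[{ω | V ω = v}.indicator (Z k) | F (v + k)]) ω := by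
    refine ae_all_iff.2 fun v => ae_all_iff.2 fun k => ?_
    by_cases hk : 1 ≤ k
    swap
    · exact ae_of_all _ fun ω h => absurd h hk
    have hst := condExp_stopping_time_ae_eq_restrict_eq (μ := μ) (f := Z k) (hV.add_const' k) (v + k)
    have hms : MeasurableSet {ω | V ω + (k : WithTop ℕ) = ((v + k : ℕ) : WithTop ℕ)} :=
      F.le (v + k) _ ((hV.add_const' k).measurableSet_eq (v + k))
    have hA : MeasurableSet[F (v + k)] {ω | V ω = (v : WithTop ℕ)} :=
      F.mono (by omega) _ (hV.measurableSet_eq v)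
    filter_upwards [(ae_restrict_iff' hms).1 hst, condExp_indicator (hZ k hk) hA]
      with ω h2 h3 _ hω
    rw [h3, Set.indicator_of_mem (by exact hω)]
    refine h2 ?_
    simp [hω]
  filter_upwards [h1, hVfin, ae_all_iff.2 h] with ω h1 hfin h
  obtain ⟨v, hv⟩ := WithTop.ne_top_iff_exists.1 hfin
  refine (h v).congr' ?_
  filter_upwards [eventually_ge_atTop 1] with k hk
  exact (h1 v k hk hv.symm).symm

theorem tendsto_condExp_of_abs_sub_le {H : ℕ → MeasurableSpace Ω} (hH : ∀ k, H k ≤ mΩ)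
    {U Z : ℕ → Ω → ℝ} {c : ℝ} (hU : ∀ k, 1 ≤ k → Integrable (U k) μ)
    (hZ : ∀ k, 1 ≤ k → Integrable (Z k) μ)
    (hle : ∀ k, 1 ≤ k → ∀ᵐ ω ∂μ, |U k ω - c| ≤ Z k ω)
    (h : ∀ᵐ ω ∂μ, Tendsto (fun k => (μ[Z k | H k]) ω) atTop (𝓝 0)) :
    ∀ᵐ ω ∂μ, Tendsto (fun k => (μ[U k | H k]) ω) atTop (𝓝 c) := by
  have h1 : ∀ᵐ ω ∂μ, ∀ k, 1 ≤ k → |(μ[U k | H k]) ω - c| ≤ (μ[Z k | H k]) ω := by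
    refine ae_all_iff.2 fun k => ?_
    by_cases hk : 1 ≤ k
    swap
    · exact ae_of_all _ fun ω h => absurd h hk
    have hc : Integrable (fun _ : Ω => c) μ := integrable_const c
    have hsub := condExp_sub (hU k hk) hc (H k)
    rw [condExp_const (hH k)] at hsub
    have hup := condExp_mono (m := H k) ((hU k hk).sub hc) (hZ k hk) (by
      filter_upwards [hle k hk] with ω hω using (abs_le.1 hω).2)
    have hlo := condExp_mono (m := H k) (hZ k hk).neg ((hU k hk).sub hc) (by
      filter_upwards [hle k hk] with ω hω using (abs_le.1 hω).1)
    filter_upwards [hsub, hup, hlo, condExp_neg (Z k) (H k)] with ω h1 h2 h3 h4 _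
    rw [h1] at h2 h3
    rw [h4] at h3
    exact abs_le.2 ⟨h3, h2⟩
  filter_upwards [h, h1] with ω h h1
  rw [tendsto_iff_norm_sub_tendsto_zero]
  refine squeeze_zero' (Eventually.of_forall fun _ => norm_nonneg _) ?_ h
  filter_upwards [eventually_ge_atTop 1] with k hk
  exact h1 k hk

end Stopping

/-! ### Measurability of the estimates -/

section Estimates

variable {Ω : Type*} [mΩ : MeasurableSpace Ω] {n : ℕ} {X : ℕ → Ω → (Fin n → ℝ)}
  {Y γsq : ℕ → Ω → ℝ} {O : Filtration ℕ mΩ}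

open IsRegressionFlow (measurable_dotProduct)

theorem measurable_mulVec_entries {m : MeasurableSpace Ω} {M : Ω → Matrix (Fin n) (Fin n) ℝ}
    (hM : ∀ i j, Measurable fun ω => M ω i j) {x : Ω → Fin n → ℝ} (hx : Measurable x) :
    Measurable fun ω => M ω *ᵥ x ω :=
  measurable_pi_lambda _ fun i =>
    measurable_dotProduct (measurable_pi_lambda _ fun j => hM i j) hx

theorem measurable_estCov (hX : ∀ i, Measurable[O (i + 1)] (X (i + 1)))
    (hγ : ∀ i, Measurable[O (i + 1)] (γsq (i + 1))) (m : ℕ) (i j : Fin n) :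
    Measurable[O m] fun ω => estCov X γsq m ω i j := by
  induction m generalizing i j with
  | zero => exact measurable_const
  | succ m ih =>
    have ih' : ∀ i j, Measurable[O (m + 1)] fun ω => estCov X γsq m ω i j := fun i j =>
      (ih i j).mono (O.mono (by omega)) le_rfl
    have hMx : Measurable[O (m + 1)] fun ω => estCov X γsq m ω *ᵥ X (m + 1) ω :=
      measurable_mulVec_entries ih' (hX m)
    have hs := measurable_dotProduct (hX m) hMx
    have hrow : ∀ j, Measurable[O (m + 1)] fun ω => ∑ l, X (m + 1) ω l * estCov X γsq m ω l j :=
      fun j => Finset.measurable_sum _ fun l _ =>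
        ((measurable_pi_apply l).comp (hX m)).mul (ih' l j)
    have heq : (fun ω => estCov X γsq (m + 1) ω i j) = fun ω => estCov X γsq m ω i j -
        (γsq (m + 1) ω + X (m + 1) ω ⬝ᵥ (estCov X γsq m ω *ᵥ X (m + 1) ω))⁻¹ *
          ((estCov X γsq m ω *ᵥ X (m + 1) ω) i *
            ∑ l, X (m + 1) ω l * estCov X γsq m ω l j) := by
      ext ω
      rw [estCov, sub_mul, one_mul, Matrix.sub_apply, Matrix.smul_mul, Matrix.smul_apply,
        Matrix.mul_vecMulVec, Matrix.vecMulVec_mul, Matrix.vecMulVec_apply, smul_eq_mul]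
      rfl
    rw [heq]
    exact (ih' i j).sub ((((hγ m).add hs).inv).mul
      (((measurable_pi_apply i).comp hMx).mul (hrow j)))

theorem measurable_estParam (hX : ∀ i, Measurable[O (i + 1)] (X (i + 1)))
    (hY : ∀ i, Measurable[O (i + 1)] (Y (i + 1)))
    (hγ : ∀ i, Measurable[O (i + 1)] (γsq (i + 1))) (β₀ : Fin n → ℝ) (m : ℕ) :
    Measurable[O m] (estParam X Y γsq β₀ m) := by
  induction m with
  | zero => exact measurable_const
  | succ m ih =>
    have ih' : Measurable[O (m + 1)] (estParam X Y γsq β₀ m) := ih.mono (O.mono (by omega)) le_rfl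
    have hMx : Measurable[O (m + 1)] fun ω => estCov X γsq m ω *ᵥ X (m + 1) ω :=
      measurable_mulVec_entries (fun i j =>
        (measurable_estCov hX hγ m i j).mono (O.mono (by omega)) le_rfl) (hX m)
    exact ih'.add (Measurable.smul (((hY m).sub (measurable_dotProduct ih' (hX m))).div
      ((hγ m).add (measurable_dotProduct (hX m) hMx))) hMx)

end Estimates

/-! ### Integrability at a random time -/

namespace IsRegressionFlow

variable {Ω : Type*} [mΩ : MeasurableSpace Ω] {μ : Measure Ω}
  [IsProbabilityMeasure μ] {n : ℕ}
  {X : ℕ → Ω → (Fin n → ℝ)} {ε : ℕ → Ω → ℝ} {σ : ℝ}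
  {F O : Filtration ℕ mΩ} {K : ℕ → MeasurableSpace Ω}

theorem integrable_residual_sq (h : IsRegressionFlow μ X ε σ F O K) {e : ℕ → Ω → Fin n → ℝ}
    (he : ∀ m, Measurable[O m] (e m)) {κ : ℕ → Ω → ℝ} (hκ : ∀ m, Measurable[F m] (κ m))
    (hκ01 : ∀ m ω, 0 ≤ κ m ω ∧ κ m ω ≤ 1) {W : Ω → ℝ} (hWi : Integrable W μ)
    (hW : ∀ᵐ ω ∂μ, ∀ m : ℕ, m * κ m ω ≤ W ω) {E₀ d : ℝ} (hE₀ : 0 ≤ E₀) (hd : 0 < d)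
    (hb : ∀ᵐ ω ∂μ, ∀ m, e m ω ⬝ᵥ e m ω ≤
      κ m ω * (E₀ + ∑ i ∈ Finset.range m, ε (i + 1) ω ^ 2 / d))
    {V : Ω → WithTop ℕ} (hV : IsStoppingTime F V) (hVfin : ∀ᵐ ω ∂μ, V ω ≠ ⊤) {r : Ω → ℝ} (k : ℕ)
    (hr : ∀ (v : ℕ) ω, V ω = v → r ω = ε (v + k + 1) ω - X (v + k + 1) ω ⬝ᵥ e (v + k) ω) :
    Integrable (fun ω => r ω ^ 2) μ := by
  set A : ℕ → Set Ω := fun v => {ω | V ω = v} with hAdef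
  have hAF : ∀ v, MeasurableSet[F v] (A v) := fun v => hV.measurableSet_eq v
  have hA : ∀ v, MeasurableSet (A v) := fun v => F.le v _ (hAF v)
  have hdisj : Pairwise (Function.onFun Disjoint A) := by
    intro v w hvw
    refine Set.disjoint_left.2 fun ω (h1 : V ω = v) (h2 : V ω = w) => hvw ?_
    exact_mod_cast h1.symm.trans h2
  set M : ℝ := ∫ ω, X 1 ω ⬝ᵥ X 1 ω ∂μ with hM
  have hM0 : 0 ≤ M := integral_nonneg fun ω => dotProduct_self_nonneg' _
  set T : Ω → ℝ := fun ω => 2 * σ ^ 2 + 2 * M * (E₀ + W ω * (σ ^ 2 / d)) with hT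
  have hEWi : Integrable (fun ω => E₀ + W ω * (σ ^ 2 / d)) μ :=
    (integrable_const _).add (hWi.mul_const _)
  have hTi : Integrable T μ := (integrable_const _).add (hEWi.const_mul _)
  have hlocal : ∀ v, IntegrableOn (fun ω => r ω ^ 2) (A v) μ ∧
      ∫ ω in A v, ‖r ω ^ 2‖ ∂μ ≤ ∫ ω in A v, T ω ∂μ := by
    intro v
    have hBi : Integrable (fun ω => κ (v + k) ω * (E₀ + (v + k : ℕ) * (σ ^ 2 / d))) μ := by
      refine Integrable.mul_const (Integrable.of_bound
        ((hκ (v + k)).mono (F.le _) le_rfl).aestronglyMeasurable 1 (ae_of_all _ fun ω => ?_)) _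
      rw [Real.norm_of_nonneg (hκ01 _ ω).1]
      exact (hκ01 _ ω).2
    have hee := h.condLE_error he hκ hκ01 hd hb (le_refl (v + k))
    have hAm : MeasurableSet[F (v + k)] (A v) := F.mono (by omega) _ (hAF v)
    have h1 := hee.integral_indicator_le (F.le _) hAm hBi
    set Z : Ω → ℝ := (A v).indicator fun ω => e (v + k) ω ⬝ᵥ e (v + k) ω with hZ
    have hZi : Integrable Z μ := hee.1.indicator (hA v)
    have hZm : Measurable[O (v + k)] Z :=
      (measurable_dot.comp (he _)).indicator (h.F_le_O _ _ hAm)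
    have hZA : ∫ ω, Z ω ∂μ = ∫ ω in A v, e (v + k) ω ⬝ᵥ e (v + k) ω ∂μ := integral_indicator (hA v)
    have hXZ := h.integrable_X_sq_mul (v + k) hZi hZm
    have hXZ' := h.integral_X_sq_mul (v + k) hZm
    have hε : CondLE μ (F (v + k)) (fun ω => ε (v + k + 1) ω ^ 2) (fun _ => σ ^ 2) := by
      have := h.condLE_mul_ε_sq (v + k) (v + k) (CondLE.const (μ := μ) (F.le _) 1) measurable_const
      simpa using this
    have hε' := hε.integral_indicator_le (F.le _) hAm (integrable_const _)
    have hUi : Integrable (fun ω => 2 * ε (v + k + 1) ω ^ 2 +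
        2 * ((X (v + k + 1) ω ⬝ᵥ X (v + k + 1) ω) * Z ω)) μ :=
      (hε.1.const_mul 2).add (hXZ.const_mul 2)
    have hle : ∀ ω ∈ A v, r ω ^ 2 ≤ 2 * ε (v + k + 1) ω ^ 2 +
        2 * ((X (v + k + 1) ω ⬝ᵥ X (v + k + 1) ω) * Z ω) := fun ω hω => by
      rw [hr v ω hω, hZ, Set.indicator_of_mem hω]
      have := dotProduct_sq_le (X (v + k + 1) ω) (e (v + k) ω)
      nlinarith [sq_nonneg (ε (v + k + 1) ω + X (v + k + 1) ω ⬝ᵥ e (v + k) ω)]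
    have hi : IntegrableOn (fun ω => r ω ^ 2) (A v) μ := by
      have hrm : Measurable fun ω =>
          (ε (v + k + 1) ω - X (v + k + 1) ω ⬝ᵥ e (v + k) ω) ^ 2 :=
        ((h.measurable_ε (v + k)).sub (measurable_dotProduct (h.measurable_X (v + k))
          ((he (v + k)).mono (O.le _) le_rfl))).pow_const 2
      refine Integrable.mono' hUi.integrableOn (hrm.aestronglyMeasurable.restrict.congr ?_) ?_
      · filter_upwards [ae_restrict_mem (hA v)] with ω hω
        rw [hr v ω hω]
      · filter_upwards [ae_restrict_mem (hA v)] with ω hω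
        rw [Real.norm_of_nonneg (sq_nonneg _)]
        exact hle ω hω
    refine ⟨hi, ?_⟩
    calc ∫ ω in A v, ‖r ω ^ 2‖ ∂μ ≤ ∫ ω in A v, (2 * ε (v + k + 1) ω ^ 2 +
          2 * ((X (v + k + 1) ω ⬝ᵥ X (v + k + 1) ω) * Z ω)) ∂μ := by
          refine setIntegral_mono_on hi.norm hUi.integrableOn (hA v) fun ω hω => ?_
          rw [Real.norm_of_nonneg (sq_nonneg _)]
          exact hle ω hω
      _ = 2 * (∫ ω in A v, ε (v + k + 1) ω ^ 2 ∂μ) + 2 * (M * ∫ ω in A v,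
            e (v + k) ω ⬝ᵥ e (v + k) ω ∂μ) := by
          rw [integral_add (hε.1.const_mul 2).integrableOn (hXZ.const_mul 2).integrableOn,
            integral_const_mul, integral_const_mul, ← hZA, ← hXZ', ← integral_indicator (hA v),
            ← integral_indicator (hA v)]
          congr 3
          ext ω
          by_cases hω : ω ∈ A v <;> simp [Z, hω]
      _ ≤ 2 * (∫ _ in A v, σ ^ 2 ∂μ) + 2 * (M * ∫ ω in A v,
            (E₀ + W ω * (σ ^ 2 / d)) ∂μ) := by
          have h2 : ∫ ω in A v, κ (v + k) ω * (E₀ + (v + k : ℕ) * (σ ^ 2 / d)) ∂μ ≤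
              ∫ ω in A v, (E₀ + W ω * (σ ^ 2 / d)) ∂μ := by
            refine setIntegral_mono_ae hBi.integrableOn
              ((integrable_const _).add (hWi.mul_const _)).integrableOn ?_
            filter_upwards [hW] with ω hω
            rw [mul_add, ← mul_assoc, mul_comm (κ (v + k) ω) ((v + k : ℕ) : ℝ)]
            exact add_le_add (mul_le_of_le_one_left hE₀ (hκ01 _ ω).2)
              (mul_le_mul_of_nonneg_right (hω _) (by positivity))
          have h3 := h1.trans h2
          gcongr
      _ = _ := by
          rw [hT, integral_add (integrable_const _).integrableOn (hEWi.const_mul _).integrableOn,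
            integral_const_mul (2 * M)]
          simp only [setIntegral_const, smul_eq_mul]
          ring
  have hsum : Summable fun v => ∫ ω in A v, T ω ∂μ :=
    (hasSum_integral_iUnion hA hdisj hTi.integrableOn).summable
  have hU := integrableOn_iUnion_of_summable_integral_norm (fun v => (hlocal v).1)
    (Summable.of_nonneg_of_le (fun v => integral_nonneg fun _ => norm_nonneg _)
      (fun v => (hlocal v).2) hsum)
  have hae : (⋃ v, A v) =ᵐ[μ] Set.univ := by
    refine eventuallyEq_set.2 ?_
    filter_upwards [hVfin] with ω hω
    obtain ⟨v, hv⟩ := WithTop.ne_top_iff_exists.1 hω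
    simp only [Set.mem_univ, iff_true]
    exact Set.mem_iUnion.2 ⟨v, hv.symm⟩
  exact integrableOn_univ.1 (hU.congr_set_ae hae.symm)

end IsRegressionFlow

/-! ### The adaptive estimator -/

section Paths

variable {Ω : Type*} {n : ℕ} {X : ℕ → Ω → (Fin n → ℝ)} {Y ε γsq : ℕ → Ω → ℝ}
  {βstar β₀ : Fin n → ℝ} {V : Ω → WithTop ℕ}

/-- Pathwise bounds on the estimation error in terms of a control of the inverse information. -/
theorem estParam_error_le {ω : Ω} {d D κ : ℝ} (hd : 0 < d)
    (hγ : ∀ i, γsq (i + 1) ω ∈ Set.Icc d D)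
    (hmodel : ∀ i, 1 ≤ i → Y i ω = X i ω ⬝ᵥ βstar + ε i ω) (hκ : 0 ≤ κ) (m : ℕ)
    (hcoer : ∀ u, u ⬝ᵥ u ≤ κ * (u ⬝ᵥ u + ∑ i ∈ Finset.range m, (X (i + 1) ω ⬝ᵥ u) ^ 2 / D)) :
    (estParam X Y γsq β₀ m ω - βstar) ⬝ᵥ (estParam X Y γsq β₀ m ω - βstar) ≤
      κ * ((β₀ - βstar) ⬝ᵥ (β₀ - βstar) + ∑ i ∈ Finset.range m, ε (i + 1) ω ^ 2 / d) ∧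
    (estParam X Y γsq β₀ m ω - βstar) ⬝ᵥ (estParam X Y γsq β₀ m ω - βstar) ≤ κ ^ 2 *
      ((β₀ - βstar + ∑ i ∈ Finset.range m, (ε (i + 1) ω * (γsq (i + 1) ω)⁻¹) • X (i + 1) ω) ⬝ᵥ
        (β₀ - βstar +
          ∑ i ∈ Finset.range m, (ε (i + 1) ω * (γsq (i + 1) ω)⁻¹) • X (i + 1) ω)) := by
  have hγ0 : ∀ i, 0 < γsq (i + 1) ω := fun i => hd.trans_le (hγ i).1
  have heq := infoApply_estParam_sub (β₀ := β₀) hmodel hγ0 m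
  set e := estParam X Y γsq β₀ m ω - βstar with he
  have hu : e ⬝ᵥ e ≤ κ * (e ⬝ᵥ infoApply (fun i => X i ω) (fun i => γsq i ω) m e) := by
    refine (hcoer e).trans (mul_le_mul_of_nonneg_left ?_ hκ)
    rw [dotProduct_infoApply]
    refine add_le_add le_rfl (Finset.sum_le_sum fun i _ => ?_)
    exact div_le_div_of_nonneg_left (sq_nonneg _) (hγ0 i) (hγ i).2
  constructor
  · refine hu.trans (mul_le_mul_of_nonneg_left ?_ hκ)
    refine (dotProduct_infoApply_le_of_eq _ _ (fun i => ε i ω) hγ0 m e (β₀ - βstar) heq).trans ?_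
    refine add_le_add le_rfl (Finset.sum_le_sum fun i _ => ?_)
    exact div_le_div_of_nonneg_left (sq_nonneg _) hd (hγ i).1
  · have := dotProduct_self_le_sq_mul e _ hu
    rw [heq] at this
    simpa only [div_eq_mul_inv] using this

theorem shiftIdx_of_eq {ω : Ω} {v : ℕ} (hv : V ω = v) (k : ℕ) : shiftIdx V k ω = v + k := by
  rw [shiftIdx, hv]; rfl

theorem kResidual_of_eq {ω : Ω} {v : ℕ} (hv : V ω = v)
    (hmodel : ∀ i, 1 ≤ i → Y i ω = X i ω ⬝ᵥ βstar + ε i ω) (k : ℕ) :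
    kResidual X Y γsq β₀ V (k + 1) ω = ε (v + k + 1) ω -
      X (v + k + 1) ω ⬝ᵥ (estParam X Y γsq β₀ (v + k) ω - βstar) := by
  rw [kResidual, shiftIdx_of_eq hv, ← add_assoc, Nat.add_sub_cancel,
    hmodel _ (by omega), dotProduct_sub]
  ring

theorem xiSq_of_eq {ω : Ω} {v : ℕ} (hv : V ω = v)
    (hmodel : ∀ i, 1 ≤ i → Y i ω = X i ω ⬝ᵥ βstar + ε i ω) (f : ℕ → Ω → ℝ) (k : ℕ) :
    xiSq (kResidual X Y γsq β₀ V) f k ω = IsRegressionFlow.residualAverage X ε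
      (fun m ω => estParam X Y γsq β₀ m ω - βstar) (initOne f) v k ω := by
  rw [xiSq_eq_average, IsRegressionFlow.residualAverage]
  congr 1
  refine Finset.sum_congr rfl fun j _ => ?_
  rw [kResidual_of_eq hv hmodel]

theorem gain_mem_Icc {ω : Ω} {τ : ℕ} (hτ : 1 ≤ τ) {δ Δ : ℝ} {ξ : ℕ → ℝ} (hfin : V ω ≠ ⊤)
    (hbefore : ∀ k : ℕ, 1 ≤ k → (k : WithTop ℕ) ≤ V ω → γsq k ω ∈ Set.Icc δ Δ)
    (hafter : ∀ k, 1 ≤ k → γsq (shiftIdx V k ω) ω = phiTrunc τ (ξ k)) (i : ℕ) :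
    γsq (i + 1) ω ∈ Set.Icc (min δ (τ : ℝ)⁻¹) (max Δ τ) := by
  obtain ⟨v, hv⟩ := WithTop.ne_top_iff_exists.1 hfin
  rcases Nat.lt_or_ge v (i + 1) with h | h
  · have h1 := hafter (i + 1 - v) (by omega)
    rw [shiftIdx_of_eq hv.symm, show v + (i + 1 - v) = i + 1 by omega] at h1
    rw [h1]
    have := phiTrunc_mem hτ (ξ (i + 1 - v))
    exact ⟨(min_le_right _ _).trans this.1, this.2.trans (le_max_right _ _)⟩
  · have h1 := hbefore (i + 1) (by omega) (by rw [← hv]; exact WithTop.coe_le_coe.2 h)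
    exact ⟨(min_le_left _ _).trans h1.1, h1.2.trans (le_max_left _ _)⟩

end Paths

namespace IsRegressionFlow

variable {Ω : Type*} [mΩ : MeasurableSpace Ω] {μ : Measure Ω}
  [IsProbabilityMeasure μ] {n : ℕ}
  {X : ℕ → Ω → (Fin n → ℝ)} {ε : ℕ → Ω → ℝ} {σ : ℝ}
  {F O : Filtration ℕ mΩ} {K : ℕ → MeasurableSpace Ω}

/-- The inverse gain at time `i`, with the contribution of observation `i` to the running average
removed. -/
noncomputable def predictedGain (τ : ℕ) (X : ℕ → Ω → (Fin n → ℝ)) (ε : ℕ → Ω → ℝ)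
    (e : ℕ → Ω → Fin n → ℝ) (φ : ℕ → Ω → ℝ) (v i : ℕ) (ω : Ω) : ℝ :=
  if i ≤ v then 0 else
    (phiTrunc τ ((1 - 1 / ((i - v : ℕ) : ℝ)) * residualAverage X ε e φ v (i - 1 - v) ω))⁻¹

theorem residualAverage_succ (e : ℕ → Ω → Fin n → ℝ) (φ : ℕ → Ω → ℝ) (v k : ℕ) (ω : Ω) :
    residualAverage X ε e φ v (k + 1) ω =
      1 / ((k : ℝ) + 1) *
        (φ (k + 1) ω * (ε (v + k + 1) ω - X (v + k + 1) ω ⬝ᵥ e (v + k) ω) ^ 2) +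
      (1 - 1 / ((k : ℝ) + 1)) * residualAverage X ε e φ v k ω := by
  rcases Nat.eq_zero_or_pos k with rfl | hk
  · simp [residualAverage]
  · have : (0 : ℝ) < k := by exact_mod_cast hk
    rw [residualAverage, residualAverage, Finset.sum_range_succ]
    push_cast
    field_simp
    ring

theorem measurable_predictedGain (h : IsRegressionFlow μ X ε σ F O K) {τ : ℕ} (hτ : 1 ≤ τ)
    {e : ℕ → Ω → Fin n → ℝ} (he : ∀ m, Measurable[O m] (e m)) {φ : ℕ → Ω → ℝ} {v : ℕ}
    (hφ : ∀ j, Measurable[F (v + j + 1)] (φ (j + 1))) (i : ℕ) :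
    Measurable[O i] (predictedGain τ X ε e φ v (i + 1)) := by
  unfold predictedGain
  by_cases hi : i + 1 ≤ v
  · simp only [hi, if_true]
    exact measurable_const
  · simp only [hi, if_false]
    have hr : Measurable[O i] (residualAverage X ε e φ v (i + 1 - 1 - v)) := by
      refine Measurable.div_const (Finset.measurable_sum _ fun j hj => ?_) _
      have hj' := Finset.mem_range.1 hj
      have h1 : Measurable[O i] (φ (j + 1)) :=
        (hφ j).mono ((h.F_le_O _).trans (O.mono (by omega))) le_rfl
      have h2 : Measurable[O i] (X (v + j + 1)) :=
        (h.meas_X (v + j)).mono ((h.F_le_O _).trans (O.mono (by omega))) le_rfl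
      have h3 : Measurable[O i] (e (v + j)) := (he _).mono (O.mono (by omega)) le_rfl
      exact h1.mul (((h.measurable_ε_of_lt (by omega)).sub
        (measurable_dotProduct h2 h3)).pow_const 2)
    exact ((measurable_phiTrunc hτ).comp (hr.const_mul _)).inv

theorem abs_predictedGain_le {τ : ℕ} (hτ : 1 ≤ τ) (e : ℕ → Ω → Fin n → ℝ) (φ : ℕ → Ω → ℝ)
    (v i : ℕ) (ω : Ω) : |predictedGain τ X ε e φ v i ω| ≤ τ := by
  have h0 : (0 : ℝ) < τ := by exact_mod_cast hτ
  unfold predictedGain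
  split_ifs
  · simp
  · have h1 := (phiTrunc_mem hτ
      ((1 - 1 / ((i - v : ℕ) : ℝ)) * residualAverage X ε e φ v (i - 1 - v) ω)).1
    rw [abs_of_nonneg (inv_nonneg.2 ((inv_pos.2 h0).le.trans h1))]
    exact inv_le_of_inv_le₀ h0 h1

/-- The true inverse gain differs from the predicted one by the influence of one observation. -/
theorem sq_inv_sub_predictedGain_le {τ : ℕ} (hτ : 1 ≤ τ) (e : ℕ → Ω → Fin n → ℝ) (φ : ℕ → Ω → ℝ)
    (v i : ℕ) (hvi : v ≤ i) (ω : Ω) (hφ : 0 ≤ φ (i - v + 1) ω ∧ φ (i - v + 1) ω ≤ 1) :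
    ((phiTrunc τ (residualAverage X ε e φ v (i - v + 1) ω))⁻¹ -
        predictedGain τ X ε e φ v (i + 1) ω) ^ 2 ≤ (τ : ℝ) ^ 3 *
      min 1 (2 * ((v : ℝ) + 1) *
        (ε (i + 1) ω ^ 2 + (X (i + 1) ω ⬝ᵥ e i ω) ^ 2) / ((i : ℝ) + 1)) := by
  obtain ⟨k, rfl⟩ : ∃ k, i = v + k := ⟨i - v, by omega⟩
  have h1 : v + k - v = k := by omega
  have h2 : v + k + 1 - 1 - v = k := by omega
  have h3 : v + k + 1 - v = k + 1 := by omega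
  rw [h1] at hφ ⊢
  rw [predictedGain, if_neg (by omega), h2, h3]
  refine (sq_inv_phiTrunc_sub_le hτ _ _).trans ?_
  refine mul_le_mul_of_nonneg_left (min_le_min le_rfl ?_) (by positivity)
  rw [residualAverage_succ]
  push_cast
  rw [add_sub_cancel_right]
  set x := ε (v + k + 1) ω
  set a := X (v + k + 1) ω ⬝ᵥ e (v + k) ω
  have hk : (0 : ℝ) < (k : ℝ) + 1 := by positivity
  rw [abs_of_nonneg (mul_nonneg (by positivity) (mul_nonneg hφ.1 (sq_nonneg _)))]
  have h4 : φ (k + 1) ω * (x - a) ^ 2 ≤ 2 * (x ^ 2 + a ^ 2) := by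
    refine (mul_le_of_le_one_left (sq_nonneg _) hφ.2).trans ?_
    nlinarith [sq_nonneg (x + a)]
  have h5 : 1 / ((k : ℝ) + 1) ≤ ((v : ℝ) + 1) / ((v : ℝ) + k + 1) := by
    rw [div_le_div_iff₀ hk (by positivity)]
    nlinarith [mul_nonneg (Nat.cast_nonneg (α := ℝ) v) (Nat.cast_nonneg (α := ℝ) k)]
  calc 1 / ((k : ℝ) + 1) * (φ (k + 1) ω * (x - a) ^ 2)
      ≤ ((v : ℝ) + 1) / ((v : ℝ) + k + 1) * (2 * (x ^ 2 + a ^ 2)) :=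
        mul_le_mul h5 h4 (mul_nonneg hφ.1 (sq_nonneg _)) (by positivity)
    _ = _ := by ring

end IsRegressionFlow

open IsRegressionFlow in
theorem mainTheorem7 {Ω : Type*} [mΩ : MeasurableSpace Ω] (μ : Measure Ω)
    [IsProbabilityMeasure μ] (n : ℕ)
    -- the data and the linear model
    (X : ℕ → Ω → (Fin n → ℝ)) (Y ε : ℕ → Ω → ℝ) (βstar : Fin n → ℝ) (σ : ℝ)
    (hX : ∀ i, 1 ≤ i → Measurable (X i)) (hY : ∀ i, 1 ≤ i → Measurable (Y i))
    (hmodel : IsLinearModel μ X Y ε βstar σ)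
    -- the covariates are square integrable and are not supported on a hyperplane through 0
    (hL2 : Integrable (fun ω => X 1 ω ⬝ᵥ X 1 ω) μ)
    (hspan : ∀ v : Fin n → ℝ, v ⬝ᵥ v = 1 → μ {ω | |X 1 ω ⬝ᵥ v| = 0} < 1)
    -- the a.s. finite stopping time at which the estimator is started
    (V : Ω → WithTop ℕ) (hV : IsStoppingTime (sigmaUpTo X hX) V)
    (hVfin : ∀ᵐ ω ∂μ, V ω ≠ ⊤)
    -- the forgetting factors
    (f : ℕ → Ω → ℝ)
    (hf_mem : ∀ᵐ ω ∂μ, ∀ k, 1 ≤ k → f k ω ∈ Set.Icc (0 : ℝ) 1)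
    (hf_lim : ∀ᵐ ω ∂μ, Tendsto (fun k => f k ω) atTop (𝓝 1))
    (hf_meas : ∀ k, 1 ≤ k → Measurable[(hV.add_const' k).measurableSpace] (f k))
    -- the tuning parameters: non-anticipating, bounded up to time `V`, and adaptive after `V`
    (β₀ : Fin n → ℝ) (τ : ℕ) (hτ : 1 ≤ τ) (γsq : ℕ → Ω → ℝ)
    (hγ_meas : ∀ k, 1 ≤ k →
      Measurable[sigmaUpTo (fun i ω => (X i ω, Y i ω))
        (fun i hi => (hX i hi).prodMk (hY i hi)) k] (γsq k))
    (δ Δ : ℝ) (hδ : 0 < δ)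
    (hγ_before : ∀ᵐ ω ∂μ, ∀ k : ℕ, 1 ≤ k → (k : WithTop ℕ) ≤ V ω → γsq k ω ∈ Set.Icc δ Δ)
    (hγ_after : ∀ᵐ ω ∂μ, ∀ k, 1 ≤ k → γsq (shiftIdx V k ω) ω =
      phiTrunc τ (xiSq (kResidual X Y γsq β₀ V) f k ω)) :
    -- the conditional expectations are those of integrable functions
    (∀ k, 1 ≤ k → Integrable (xiSq (kResidual X Y γsq β₀ V) f k) μ) ∧
    (∀ k, 1 ≤ k → Integrable (fun ω => γsq (shiftIdx V k ω) ω) μ) ∧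
    (∀ᵐ ω ∂μ, Tendsto
      (fun k => (μ[xiSq (kResidual X Y γsq β₀ V) f k | (hV.add_const' k).measurableSpace]) ω)
      atTop (𝓝 (σ ^ 2))) ∧
    (∀ᵐ ω ∂μ,
      phiTrunc τ (σ ^ 2) ≤
        liminf (fun k => (μ[fun ω' => γsq (shiftIdx V k ω') ω' |
          (hV.add_const' k).measurableSpace]) ω) atTop ∧
      liminf (fun k => (μ[fun ω' => γsq (shiftIdx V k ω') ω' |
          (hV.add_const' k).measurableSpace]) ω) atTop ≤
        limsup (fun k => (μ[fun ω' => γsq (shiftIdx V k ω') ω' |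
          (hV.add_const' k).measurableSpace]) ω) atTop ∧
      limsup (fun k => (μ[fun ω' => γsq (shiftIdx V k ω') ω' |
          (hV.add_const' k).measurableSpace]) ω) atTop ≤
        phiTrunc τ (σ ^ 2 + (τ : ℝ)⁻¹)) := by
  have hτ0 : (0 : ℝ) < τ := by exact_mod_cast hτ
  obtain ⟨K, h⟩ := hmodel.isRegressionFlow hX hY hL2
  set F := sigmaUpTo X hX with hF
  set O := sigmaUpTo (fun i ω => (X i ω, Y i ω)) (fun i hi => (hX i hi).prodMk (hY i hi)) with hO
  set d : ℝ := min δ (τ : ℝ)⁻¹ with hddef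
  set D : ℝ := max Δ τ with hDdef
  have hd : 0 < d := lt_min hδ (inv_pos.2 hτ0)
  have hD : 0 < D := hτ0.trans_le (le_max_right _ _)
  set e : ℕ → Ω → Fin n → ℝ := fun m ω => estParam X Y γsq β₀ m ω - βstar with hedef
  set ξ := xiSq (kResidual X Y γsq β₀ V) f with hξ
  have hmod : ∀ ω i, 1 ≤ i → Y i ω = X i ω ⬝ᵥ βstar + ε i ω := fun ω i hi => hmodel.model i hi ω
  have hOX : ∀ i, Measurable[O (i + 1)] (X (i + 1)) := fun i =>
    (h.meas_X i).mono (h.F_le_O _) le_rfl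
  have hOY : ∀ i, Measurable[O (i + 1)] (Y (i + 1)) := fun i =>
    measurable_snd.comp (measurable_sigmaUpTo (Z := fun i ω => (X i ω, Y i ω))
      (fun i hi => (hX i hi).prodMk (hY i hi)) (by omega) le_rfl)
  have he : ∀ m, Measurable[O m] (e m) := fun m =>
    (measurable_estParam hOX hOY (fun i => hγ_meas (i + 1) (by omega)) β₀ m).sub_const βstar
  have hγ : ∀ᵐ ω ∂μ, ∀ i, γsq (i + 1) ω ∈ Set.Icc d D := by
    filter_upwards [hVfin, hγ_before, hγ_after] with ω h1 h2 h3
    exact gain_mem_Icc hτ h1 h2 h3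
  obtain ⟨κ, W, hκm, hκ01, hWi, hW, hcoer⟩ :=
    exists_inverse_info_control (F := F) h.meas_X h.iIndep_X h.ident_X hspan hD
  have hb : ∀ᵐ ω ∂μ, ∀ m, e m ω ⬝ᵥ e m ω ≤ κ m ω *
      ((β₀ - βstar) ⬝ᵥ (β₀ - βstar) + ∑ i ∈ Finset.range m, ε (i + 1) ω ^ 2 / d) := by
    filter_upwards [hγ] with ω hω m
    exact (estParam_error_le hd hω (hmod ω) (hκ01 m ω).1 m (hcoer m ω)).1
  have hb' : ∀ᵐ ω ∂μ, ∀ m, e m ω ⬝ᵥ e m ω ≤ κ m ω ^ 2 *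
      ((β₀ - βstar + ∑ i ∈ Finset.range m, (ε (i + 1) ω * (γsq (i + 1) ω)⁻¹) • X (i + 1) ω) ⬝ᵥ
        (β₀ - βstar +
          ∑ i ∈ Finset.range m, (ε (i + 1) ω * (γsq (i + 1) ω)⁻¹) • X (i + 1) ω)) := by
    filter_upwards [hγ] with ω hω m
    exact (estParam_error_le hd hω (hmod ω) (hκ01 m ω).1 m (hcoer m ω)).2
  have hf01 : ∀ᵐ ω ∂μ, ∀ j, 0 ≤ initOne f (j + 1) ω ∧ initOne f (j + 1) ω ≤ 1 := by
    filter_upwards [hf_mem] with ω hω j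
    unfold initOne
    split_ifs
    · exact ⟨zero_le_one, le_rfl⟩
    · exact hω (j + 1) (by omega)
  have hflim : ∀ᵐ ω ∂μ, Tendsto (fun j => initOne f j ω) atTop (𝓝 1) := by
    filter_upwards [hf_lim] with ω hω
    refine hω.congr' ?_
    filter_upwards [eventually_gt_atTop 1] with j hj
    simp [initOne, not_le.2 hj]
  have hfm : ∀ j, Measurable (initOne f (j + 1)) := fun j => by
    unfold initOne
    split_ifs
    · exact measurable_const
    · exact (hf_meas (j + 1) (by omega)).mono (hV.add_const' _).measurableSpace_le le_rfl
  -- integrability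
  have hr2 : ∀ k, Integrable (fun ω => kResidual X Y γsq β₀ V (k + 1) ω ^ 2) μ := fun k =>
    h.integrable_residual_sq he hκm hκ01 hWi hW (dotProduct_self_nonneg' _) hd hb hV hVfin k
      fun v ω hv => kResidual_of_eq hv (hmod ω) k
  have hξi : ∀ k, Integrable (ξ k) μ := fun k => by
    have h1 : ξ k = fun ω => (∑ i ∈ Finset.range k, initOne f (i + 1) ω *
        kResidual X Y γsq β₀ V (i + 1) ω ^ 2) / k := funext fun ω => xiSq_eq_average _ _ _ _
    rw [h1]
    refine Integrable.div_const (integrable_finsetSum _ fun i _ => ?_) _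
    refine (hr2 i).mono' ((hfm i).aestronglyMeasurable.mul (hr2 i).aestronglyMeasurable) ?_
    filter_upwards [hf01] with ω hω
    rw [Real.norm_of_nonneg (mul_nonneg (hω i).1 (sq_nonneg _))]
    exact mul_le_of_le_one_left (sq_nonneg _) (hω i).2
  have hγξ : ∀ k, 1 ≤ k →
      (fun ω => γsq (shiftIdx V k ω) ω) =ᵐ[μ] fun ω => phiTrunc τ (ξ k ω) := fun k hk => by
    filter_upwards [hγ_after] with ω hω using hω k hk
  have hγi : ∀ k, 1 ≤ k → Integrable (fun ω => γsq (shiftIdx V k ω) ω) μ := fun k hk => by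
    refine Integrable.congr ?_ (hγξ k hk).symm
    refine Integrable.of_bound ((measurable_phiTrunc hτ).comp_aemeasurable
      (hξi k).aestronglyMeasurable.aemeasurable).aestronglyMeasurable (τ : ℝ)
      (ae_of_all _ fun ω => ?_)
    have := phiTrunc_mem hτ (ξ k ω)
    rw [Real.norm_of_nonneg ((inv_pos.2 hτ0).le.trans this.1)]
    exact this.2
  -- concentration from a fixed time
  have hfix : ∀ v : ℕ, ∀ᵐ ω ∂μ, Tendsto (fun k =>
      (μ[{ω | V ω = v}.indicator (fun ω => |ξ k ω - σ ^ 2|) | F (v + k)]) ω) atTop (𝓝 0) := by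
    intro v
    set A : Set Ω := {ω | V ω = v} with hAdef
    have hAF : MeasurableSet[F v] A := hV.measurableSet_eq v
    set φ : ℕ → Ω → ℝ := fun j => A.indicator (initOne f j) with hφdef
    have hφA : ∀ j ω, ω ∈ A → φ j ω = initOne f j ω := fun j ω hω => Set.indicator_of_mem hω _
    have hφm : ∀ j, Measurable[F (v + j + 1)] (φ (j + 1)) := fun j => by
      have hAj : MeasurableSet[F (v + j + 1)] A := F.mono (by omega) _ hAF
      by_cases hj : j + 1 ≤ 1
      · have : φ (j + 1) = A.indicator fun _ => 1 := by
          ext ω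
          by_cases hω : ω ∈ A <;> simp [φ, initOne, hω, hj]
        rw [this]
        exact measurable_const.indicator hAj
      · have h1 := measurable_indicator_of_stopped (hV.add_const' (j + 1))
          (hf_meas (j + 1) (by omega)) (v + (j + 1))
        have h2 : {ω | V ω + ((j + 1 : ℕ) : WithTop ℕ) = ((v + (j + 1) : ℕ) : WithTop ℕ)} = A := by
          ext ω
          simp only [hAdef, Set.mem_ofPred_eq]
          rw [Nat.cast_add v (j + 1)]
          exact WithTop.add_right_inj (WithTop.natCast_ne_top (α := ℕ) (j + 1))
        have h3 : φ (j + 1) = A.indicator (f (j + 1)) := by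
          ext ω
          by_cases hω : ω ∈ A <;> simp only [φ, initOne, hω, hj, Set.indicator_of_mem,
            Set.indicator_of_notMem, if_false, not_false_eq_true]
        rw [h3, ← h2]
        exact h1
    have hrA : ∀ ω ∈ A, ∀ k, ξ k ω = residualAverage X ε e (initOne f) v k ω :=
      fun ω hω k => xiSq_of_eq hω (hmod ω) f k
    have hrA' : ∀ ω ∈ A, ∀ k, residualAverage X ε e φ v k ω = ξ k ω := fun ω hω k => by
      rw [hrA ω hω, residualAverage, residualAverage]
      simp only [hφA _ ω hω]
    set C : ℝ := (τ : ℝ) ^ 3 + (d⁻¹) ^ 2 with hCdef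
    have hC0 : 0 ≤ C := by positivity
    have hL0 : (0 : ℝ) ≤ 2 * ((v : ℝ) + 1) := by positivity
    have hDL' : ∀ᵐ ω ∂μ, ω ∈ A → ∀ i, v ≤ i →
        ((γsq (i + 1) ω)⁻¹ - predictedGain τ X ε e φ v (i + 1) ω) ^ 2 ≤ (τ : ℝ) ^ 3 * min 1
          (2 * ((v : ℝ) + 1) * (ε (i + 1) ω ^ 2 + (X (i + 1) ω ⬝ᵥ e i ω) ^ 2) / ((i : ℝ) + 1)) := by
      filter_upwards [hγ_after, hf01] with ω h1 h2 hω i hi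
      have h3 := h1 (i - v + 1) (by omega)
      rw [shiftIdx_of_eq hω, show v + (i - v + 1) = i + 1 by omega, ← hrA' ω hω] at h3
      rw [h3]
      refine sq_inv_sub_predictedGain_le hτ e φ v i hi ω ?_
      rw [hφA _ ω hω]
      exact h2 _
    have hDL : ∀ᵐ ω ∂μ, ω ∈ A → ∀ i, v ≤ i →
        ((γsq (i + 1) ω)⁻¹ - predictedGain τ X ε e φ v (i + 1) ω) ^ 2 ≤ C * min 1
          (2 * ((v : ℝ) + 1) * (ε (i + 1) ω ^ 2 + (X (i + 1) ω ⬝ᵥ e i ω) ^ 2) / ((i : ℝ) + 1)) := by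
      filter_upwards [hDL'] with ω h1 hω i hi
      refine (h1 hω i hi).trans (mul_le_mul_of_nonneg_right ?_
        (le_min zero_le_one (by positivity)))
      exact le_add_of_nonneg_right (sq_nonneg _)
    have hDC : ∀ᵐ ω ∂μ, ω ∈ A → ∀ i,
        ((γsq (i + 1) ω)⁻¹ - predictedGain τ X ε e φ v (i + 1) ω) ^ 2 ≤ C := by
      filter_upwards [hDL, hγ] with ω h1 h2 hω i
      rcases Nat.lt_or_ge i v with hi | hi
      · rw [predictedGain, if_pos (by omega), sub_zero]
        have h3 : (γsq (i + 1) ω)⁻¹ ≤ d⁻¹ := inv_anti₀ hd (h2 i).1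
        have h4 : 0 ≤ (γsq (i + 1) ω)⁻¹ := inv_nonneg.2 (hd.le.trans (h2 i).1)
        exact (pow_le_pow_left₀ h4 h3 2).trans (le_add_of_nonneg_left (by positivity))
      · exact (h1 hω i hi).trans (mul_le_of_le_one_right hC0 (min_le_left _ _))
    have hGm : ∀ i, Measurable ((fun i ω => (γsq i ω)⁻¹) (i + 1)) := fun i =>
      ((hγ_meas (i + 1) (by omega)).mono (O.le _) le_rfl).inv
    have hEB : ∀ m N, m ≤ N → CondLE μ (F N) (A.indicator fun ω => e m ω ⬝ᵥ e m ω)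
        (errorBound μ X ε σ κ ((β₀ - βstar) ⬝ᵥ (β₀ - βstar)) d C (2 * ((v : ℝ) + 1)) τ v m) :=
      fun m N hmN => h.condLE_error_refined (e₀ := β₀ - βstar) (G := fun i ω => (γsq i ω)⁻¹)
      (g := predictedGain τ X ε e φ v) (c := (τ : ℝ)) he hκm hκ01 hd hb hGm
      (h.measurable_predictedGain hτ he hφm) hb'
      (fun i ω => abs_predictedGain_le hτ e φ v (i + 1) ω) hC0 hL0 (F.le v _ hAF) hDC hDL hmN
    have hEBlim : ∀ᵐ ω ∂μ, Tendsto (fun m => errorBound μ X ε σ κ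
        ((β₀ - βstar) ⬝ᵥ (β₀ - βstar)) d C (2 * ((v : ℝ) + 1)) τ v m ω) atTop (𝓝 0) := by
      filter_upwards [hW, h.ae_exists_sum_X_sq_le] with ω hW hS
      obtain ⟨C', _, hC'⟩ := hS
      exact h.tendsto_errorBound (fun m => hκ01 m ω) hW (dotProduct_self_nonneg' _) hd hC0 hL0 v hC'
    have hconv := h.tendsto_condExp_residualAverage he hAF hEB hEBlim (φ := initOne f) hφm
      hf01 hflim
    have hcongr : ∀ k, (A.indicator fun ω => |ξ k ω - σ ^ 2|) =
        A.indicator fun ω => |residualAverage X ε e (initOne f) v k ω - σ ^ 2| := fun k => by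
      ext ω
      by_cases hω : ω ∈ A
      · simp only [Set.indicator_of_mem hω, hrA ω hω]
      · simp only [Set.indicator_of_notMem hω]
    simpa only [hcongr] using hconv
  have hZi : ∀ k, 1 ≤ k → Integrable (fun ω => |ξ k ω - σ ^ 2|) μ := fun k _ =>
    ((hξi k).sub (integrable_const _)).abs
  have hdev := tendsto_condExp_stopped hV hVfin hZi hfix
  have hH : ∀ k : ℕ, (hV.add_const' k).measurableSpace ≤ mΩ := fun k =>
    (hV.add_const' k).measurableSpace_le
  have hlimξ := tendsto_condExp_of_abs_sub_le hH (fun k _ => hξi k) hZi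
    (fun k _ => ae_of_all _ fun ω => le_rfl) hdev
  have hlimγ := tendsto_condExp_of_abs_sub_le (c := phiTrunc τ (σ ^ 2)) hH hγi hZi
    (fun k hk => by
      filter_upwards [hγξ k hk] with ω hω
      rw [hω]
      exact abs_phiTrunc_sub_le hτ _ _) hdev
  refine ⟨fun k _ => hξi k, hγi, hlimξ, ?_⟩
  filter_upwards [hlimγ] with ω hω
  rw [hω.liminf_eq, hω.limsup_eq]
  exact ⟨le_rfl, le_rfl, phiTrunc_mono hτ (le_add_of_nonneg_right (inv_pos.2 hτ0).le)⟩
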